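/- Let $a,b$ be integers with $2\le a\le b$, let $p>0$ be real, let $q$ be an even integer with $2\le q\le a$, and let $$f(x,y)=x^ay^b+x^{a-q}y^b e^{-1/|y|^p},$$ where $e^{-1/|y|^p}$ is given the value $0$ at $y=0$. Let $U$ be an open neighbourhood of the origin in $\mathbb R^2$, and let $C_0^\infty(U)$ be the set of real-valued smooth functions with compact support contained in $U$. For $\varphi\in C_0^\infty(U)$ put $$Z_f(\varphi)(s)=\int_{\mathbb R^2}|f(x,y)|^s\varphi(x,y)\,dx\,dy\qquad(\operatorname{Re}s>0),$$ let $m_0(f,\varphi)\in[0,\infty]$ be the supremum of all $\rho>0$ such that $Z_f(\varphi)$ can be meromorphically continued to the half-plane $\operatorname{Re}s>-\rho$, and let $m_0(f)=\inf\{m_0(f,\varphi):\varphi\in C_0^\infty(U)\}$. Assume that $p<b/a-1$ or that $b/a$ is not an odd integer, and assume that $(b/a-1)/p$ is not an integer. Then for every $\varphi\in C_0^\infty(U)$ the function $Z_f(\varphi)$ has a meromorphic continuation to the half-plane $\operatorname{Re}s>-1/a$, and if $\varphi(0,0)\ne0$, then this continuation cannot be continued meromorphically to any open neighbourhood of $s=-1/a$;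 that is, for no open $V\subseteq\mathbb C$ containing $-1/a$ is there a meromorphic function on $\{\operatorname{Re}s>-1/a\}\cup V$ that agrees with $Z_f(\varphi)$ on $\operatorname{Re}s>0$. Consequently $m_0(f)=1/a$. -/

import Mathlib

namespace LocalZeta

/-- The function `y ↦ e^{-1/|y|^p}` on `ℝ`, extended by the value `0` at `y = 0`. -/
noncomputable def flatExp (p : ℝ) (y : ℝ) : ℝ :=
  if y = 0 then 0 else Real.exp (-1 / |y| ^ p)

/-- The function `f(x, y) = x^a y^b + x^(a-q) y^b e^{-1/|y|^p}` (used only for `q ≤ a`). -/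
noncomputable def modelFun (a b q : ℕ) (p : ℝ) (z : ℝ × ℝ) : ℝ :=
  z.1 ^ a * z.2 ^ b + z.1 ^ (a - q) * z.2 ^ b * flatExp p z.2

/-- Membership in `C_0^∞(U)`: real-valued smooth functions, extended by zero to the plane, whose
support is compact and contained in `U`. -/
structure IsTestFun (U : Set (ℝ × ℝ)) (φ : ℝ × ℝ → ℝ) : Prop where
  smooth : ContDiff ℝ (⊤ : ℕ∞) φ
  compact_support : HasCompactSupport φ
  support_subset : tsupport φ ⊆ U

/-- The integral `Z_f(φ)(s) = ∫ |f(x, y)|^s φ(x, y) dx dy`. For smooth `f` and a test function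
`φ` it converges absolutely for `Re s > 0`, and it is only evaluated there. -/
noncomputable def Z (f φ : ℝ × ℝ → ℝ) (s : ℂ) : ℂ :=
  ∫ z : ℝ × ℝ, ((|f z| : ℝ) : ℂ) ^ s * ((φ z : ℝ) : ℂ)

/-- The open half-plane `Re s > c`. -/
def halfPlane (c : ℝ) : Set ℂ := {s : ℂ | c < s.re}

/-- `Z_f(φ)`, given by the integral on `Re s > 0`, extends to a meromorphic function on `D`. As
usual, the value which `F` takes at a pole is irrelevant. This is used only for open sets `D`
that contain the half-plane `Re s > 0`. -/
def HasMeromorphicContinuation (f φ : ℝ × ℝ → ℝ) (D : Set ℂ) : Prop :=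
  ∃ F : ℂ → ℂ, MeromorphicOn F D ∧ Set.EqOn F (Z f φ) (halfPlane 0)

/-- `m_0(f, φ)`: the supremum in `[0, ∞]` of all `ρ > 0` such that `Z_f(φ)` can be meromorphically
continued to the half-plane `Re s > -ρ`. -/
noncomputable def m0At (f φ : ℝ × ℝ → ℝ) : ENNReal :=
  sSup {t : ENNReal | ∃ ρ : ℝ, 0 < ρ ∧ HasMeromorphicContinuation f φ (halfPlane (-ρ)) ∧
    t = ENNReal.ofReal ρ}

/-- `m_0(f)`: the infimum of `m_0(f, φ)` over `φ ∈ C_0^∞(U)`. -/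
noncomputable def m0 (U : Set (ℝ × ℝ)) (f : ℝ × ℝ → ℝ) : ENNReal :=
  sInf {t : ENNReal | ∃ φ : ℝ × ℝ → ℝ, IsTestFun U φ ∧ t = m0At f φ}

end LocalZeta

open MeasureTheory Set Filter Topology

namespace LocalZeta

/-! Since `q` is even, `|f|` is invariant under sign changes of `x` and `y`, so the integral folds
onto the open quadrant with `φ` replaced by `Φ = signSum φ`, which is even in `y` and satisfies
`Φ(0,0) = 4φ(0,0)`. There `|f|^s = (x^a y^b)^s (1 + h)^s` with `h = e^{-1/y^p}/x^q`, and writing `(1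
+ h)^s = 1 + ((1 + h)^s - 1)` splits `Z` into a monomial part `monoZ` and a flat part `flatZ`
(`Z_modelFun_eq`).

Integrating the monomial part by parts `N` times in `y`, with `b ≤ a(N+1)`, continues it
meromorphically to `Re s > -1/a` (`monoZ_zero_mul_prod`, `differentiableOn_monoZ`). The flat part is
holomorphic there: `log(1 + h) ≤ h^θ/θ` costs only `x^{-qθ}` with `θ` as small as desired, while
`e^{-θ/y^p}` absorbs every negative power of `y` (`differentiableOn_flatZ`).

The obstruction at `-1/a` is seen along `s = (δ-1)/a`, `δ → 0+`. Put `κ = (b/a - 1)/p`. The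
substitution `x = t^{1/δ}`, `y = δ^{1/p} v` turns `h` into `flatRatio(t,v)^{1/δ}`, and dominated
convergence gives `δ^{1+κ} flatZ → -Φ(0,0) ∫ v^{-b/a}` over the region `flatRatio > 1`, a nonzero
limit if `φ(0,0) ≠ 0` (`tendsto_rpow_mul_flatZ`). The monomial part is of smaller order
(`exists_norm_monoZ_le`): it is `O(δ^{-1})` or `O(δ^{-2})`, the latter being needed only when `b/a`
is an odd integer, where the hypothesis forces `κ > 1`. So a continuation past `-1/a` would grow
exactly like `δ^{-(1+κ)}` there, whereas a meromorphic function has an integral growth exponent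
(`exists_int_of_tendsto_rpow_mul`); but `κ` is not an integer. -/

/-! ### Parameter integrals and elementary inequalities -/

/-- An integral depending on a complex parameter is holomorphic if the integrand is entire in the
parameter and locally uniformly dominated. -/
theorem differentiableOn_integral_of_locally_dominated {α : Type*} [MeasurableSpace α]
    {μ : Measure α} {F : ℂ → α → ℂ} {U : Set ℂ}
    (hmeas : ∀ s, AEStronglyMeasurable (F s) μ)
    (hdiff : ∀ z, Differentiable ℂ fun s => F s z)
    (hbound : ∀ s₀ ∈ U, ∃ W ∈ 𝓝 s₀, ∃ g : α → ℝ, Integrable g μ ∧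
      ∀ᵐ z ∂μ, ∀ s ∈ W, ‖F s z‖ ≤ g z) :
    DifferentiableOn ℂ (fun s => ∫ z, F s z ∂μ) U := by
  intro s₀ hs₀
  obtain ⟨W, hW, g, hg, hFg⟩ := hbound s₀ hs₀
  obtain ⟨r, hr, hrW⟩ := Metric.mem_nhds_iff.1 hW
  have hball : ∀ s ∈ Metric.ball s₀ (r / 2), Metric.closedBall s (r / 4) ⊆ Metric.ball s₀ r := by
    intro s hs t ht
    rw [Metric.mem_ball] at *
    rw [Metric.mem_closedBall] at ht
    linarith [dist_triangle t s s₀]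
  have hmem : s₀ ∈ Metric.ball s₀ (r / 2) := Metric.mem_ball_self (by positivity)
  -- Cauchy's estimate on circles of radius `r/4` dominates the derivative by the bound for `F`
  -- itself.
  have hderiv : ∀ᵐ z ∂μ, ∀ s ∈ Metric.ball s₀ (r / 2),
      ‖deriv (fun s => F s z) s‖ ≤ g z / (r / 4) := by
    filter_upwards [hFg] with z hz s hs
    refine Complex.norm_deriv_le_of_forall_mem_sphere_norm_le (by positivity)
      (hdiff z).diffContOnCl fun t ht => hz t (hrW (hball s hs (Metric.sphere_subset_closedBall ht)))
  -- The derivative is measurable as a pointwise limit of difference quotients.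
  have hmeas' : AEStronglyMeasurable (fun z => deriv (fun s => F s z) s₀) μ := by
    have hlim : ∀ z, Tendsto (fun n : ℕ => ((1 : ℂ) / (n + 1))⁻¹ *
        (F (s₀ + 1 / (n + 1)) z - F s₀ z)) atTop (𝓝 (deriv (fun s => F s z) s₀)) := by
      intro z
      have h1 := (hdiff z s₀).hasDerivAt
      rw [hasDerivAt_iff_tendsto_slope_zero] at h1
      have h2 : Tendsto (fun n : ℕ => (1 : ℂ) / (n + 1)) atTop (𝓝[≠] 0) := by
        rw [tendsto_nhdsWithin_iff]
        refine ⟨tendsto_one_div_add_atTop_nhds_zero_nat, .of_forall fun n => ?_⟩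
        have : (n : ℂ) + 1 ≠ 0 := Nat.cast_add_one_ne_zero n
        simp [this]
      simpa [smul_eq_mul, Function.comp_def] using h1.comp h2
    exact aestronglyMeasurable_of_tendsto_ae atTop
      (fun n => ((hmeas _).sub (hmeas _)).const_mul _) (.of_forall hlim)
  refine (hasDerivAt_integral_of_dominated_loc_of_deriv_le (bound := fun z => g z / (r / 4))
    (F' := fun s z => deriv (fun s => F s z) s)
    (Metric.ball_mem_nhds s₀ (by positivity : 0 < r / 2)) (.of_forall hmeas) ?_ hmeas' hderiv
    (hg.div_const _) (.of_forall fun z s _ => (hdiff z s).hasDerivAt)).2.differentiableAt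
    |>.differentiableWithinAt
  exact hg.mono' (hmeas s₀) (hFg.mono fun z hz => hz s₀ (mem_of_mem_nhds hW))

/-- Mean value inequality on the segment from `0` to `w`, on which `Re` lies between `0` and `Re w`.
-/
theorem norm_cexp_sub_one_le (w : ℂ) : ‖Complex.exp w - 1‖ ≤ ‖w‖ * max 1 (Real.exp w.re) := by
  have h := (convex_segment (0 : ℂ) w).norm_image_sub_le_of_norm_deriv_le (𝕜 := ℂ)
    (f := Complex.exp) (C := max 1 (Real.exp w.re)) (fun x _ => Complex.differentiableAt_exp)
    (fun x hx => ?_) (left_mem_segment ℝ 0 w) (right_mem_segment ℝ 0 w)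
  · simpa [mul_comm] using h
  · rw [Complex.deriv_exp, Complex.norm_exp]
    obtain ⟨u, v, hu, hv, huv, rfl⟩ := hx
    have hre : (u • (0 : ℂ) + v • w).re = v * w.re := by simp
    rw [hre]
    rcases le_total w.re 0 with h0 | h0
    · exact le_max_of_le_left (Real.exp_le_one_iff.2 (mul_nonpos_of_nonneg_of_nonpos hv h0))
    · exact le_max_of_le_right (Real.exp_le_exp.2 (by nlinarith))

/-- Subadditivity of `t ↦ t^θ` gives `θ log(1 + h) ≤ log(1 + h^θ) ≤ h^θ`. A small `θ` makes the
singularity of `h` in `x` harmless and leaves its flatness in `y` intact. -/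
theorem log_one_add_le_rpow {h θ : ℝ} (hh : 0 ≤ h) (hθ : 0 < θ) (hθ1 : θ ≤ 1) :
    Real.log (1 + h) ≤ h ^ θ / θ := by
  rw [le_div_iff₀ hθ, mul_comm, ← Real.log_rpow (by linarith)]
  have h1 : (1 + h) ^ θ ≤ 1 + h ^ θ := by
    lift h to NNReal using hh
    have h2 := NNReal.rpow_add_le_add_rpow 1 h hθ.le hθ1
    rw [NNReal.one_rpow] at h2
    exact_mod_cast h2
  have h2 : 0 ≤ h ^ θ := Real.rpow_nonneg hh θ
  calc Real.log ((1 + h) ^ θ) ≤ Real.log (1 + h ^ θ) :=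
        Real.log_le_log (Real.rpow_pos_of_pos (by linarith) θ) h1
    _ ≤ h ^ θ := by linarith [Real.log_le_sub_one_of_pos (by linarith : 0 < 1 + h ^ θ)]

/-- `e^{-1/y^p}` is flat at `0`: it absorbs every power of `y`. -/
theorem exists_rpow_mul_exp_neg_le {p θ : ℝ} (hp : 0 < p) (hθ : 0 < θ) (c R : ℝ) :
    ∃ C, 0 ≤ C ∧ ∀ y, 0 < y → y ≤ R → y ^ c * Real.exp (-θ / y ^ p) ≤ C := by
  -- From `e^u ≥ u^k/k!` with `u = θ/y^p`, the exponential contributes `y^{pk}`; this `k` makes the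
  -- total exponent `pk + c` nonnegative.
  obtain ⟨k, hk⟩ := exists_nat_gt (-c / p)
  have hk' : 0 ≤ p * k + c := by
    rw [div_lt_iff₀ hp] at hk; nlinarith
  refine ⟨(k.factorial / θ ^ k) * |R| ^ (p * k + c), by positivity, fun y hy hyR => ?_⟩
  have hyp : 0 < y ^ p := Real.rpow_pos_of_pos hy p
  have h1 : (θ / y ^ p) ^ k / k.factorial ≤ Real.exp (θ / y ^ p) :=
    Real.pow_div_factorial_le_exp _ (by positivity) k
  have h2 : Real.exp (-θ / y ^ p) ≤ k.factorial / θ ^ k * y ^ (p * k) := by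
    rw [neg_div, Real.exp_neg, Real.rpow_mul hy.le, Real.rpow_natCast]
    refine (inv_anti₀ (by positivity) h1).trans (le_of_eq ?_)
    rw [div_pow, inv_div, div_div_eq_mul_div]
    ring
  calc y ^ c * Real.exp (-θ / y ^ p) ≤ y ^ c * (k.factorial / θ ^ k * y ^ (p * k)) := by gcongr
    _ = k.factorial / θ ^ k * y ^ (p * k + c) := by rw [Real.rpow_add hy]; ring
    _ ≤ _ := by gcongr; exact hyR.trans (le_abs_self R)

/-! ### Folding onto the quadrant, box majorants and test functions -/

/-- The open first quadrant. -/
def quadrant : Set (ℝ × ℝ) := Ioi 0 ×ˢ Ioi 0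

theorem measurableSet_quadrant : MeasurableSet quadrant := measurableSet_Ioi.prod measurableSet_Ioi

theorem restrict_quadrant : (volume : Measure (ℝ × ℝ)).restrict quadrant =
    (volume.restrict (Ioi 0)).prod (volume.restrict (Ioi (0 : ℝ))) := by
  rw [quadrant, Measure.volume_eq_prod, Measure.prod_restrict]

/-- The sum of a function over the four sign changes of the coordinates. -/
def signSum {E : Type*} [Add E] (g : ℝ × ℝ → E) (z : ℝ × ℝ) : E :=
  g (z.1, z.2) + g (-z.1, z.2) + (g (z.1, -z.2) + g (-z.1, -z.2))

theorem integral_eq_setIntegral_Ioi_add_neg {g : ℝ → ℂ} (hg : Integrable g) :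
    ∫ x, g x = ∫ x in Ioi 0, (g x + g (-x)) := by
  have h2 : IntegrableOn (fun x => g (-x)) (Ioi 0) := hg.comp_neg.integrableOn
  rw [integral_add hg.integrableOn h2, integral_comp_neg_Ioi, neg_zero, add_comm,
    intervalIntegral.integral_Iic_add_Ioi hg.integrableOn hg.integrableOn]

theorem integral_eq_setIntegral_quadrant {g : ℝ × ℝ → ℂ} (hg : Integrable g) :
    ∫ z, g z = ∫ z in quadrant, signSum g z := by
  have hneg1 : MeasurePreserving (fun z : ℝ × ℝ => (-z.1, z.2)) volume volume :=
    (Measure.measurePreserving_neg (volume : Measure ℝ)).prod (MeasurePreserving.id _)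
  have hneg2 : MeasurePreserving (fun z : ℝ × ℝ => (z.1, -z.2)) volume volume :=
    (MeasurePreserving.id _).prod (Measure.measurePreserving_neg (volume : Measure ℝ))
  set g₁ : ℝ × ℝ → ℂ := fun z => g z + g (z.1, -z.2) with hg₁
  have hi₁ : Integrable g₁ := hg.add (hneg2.integrable_comp_of_integrable hg)
  have hi₂ : Integrable (signSum g) := by
    have := hi₁.add (hneg1.integrable_comp_of_integrable hi₁)
    refine this.congr (.of_forall fun z => ?_)
    simp [signSum, hg₁]; ring
  calc ∫ z, g z = ∫ x, ∫ y, g (x, y) := by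
        rw [Measure.volume_eq_prod] at hg ⊢; exact integral_prod _ hg
    _ = ∫ x, ∫ y in Ioi 0, g₁ (x, y) := by
        refine integral_congr_ae ?_
        rw [Measure.volume_eq_prod] at hg
        filter_upwards [hg.prod_right_ae] with x hx
        exact integral_eq_setIntegral_Ioi_add_neg hx
    _ = ∫ z in univ ×ˢ Ioi 0, g₁ z := by
        rw [Measure.volume_eq_prod] at hi₁ ⊢
        rw [setIntegral_prod _ hi₁.integrableOn, Measure.restrict_univ]
    _ = ∫ y in Ioi 0, ∫ x, g₁ (x, y) := by
        rw [Measure.volume_eq_prod] at hi₁ ⊢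
        rw [← Measure.prod_restrict, Measure.restrict_univ]
        refine integral_prod_symm _ ?_
        have := hi₁.integrableOn (s := univ ×ˢ Ioi (0 : ℝ))
        rwa [IntegrableOn, ← Measure.prod_restrict, Measure.restrict_univ] at this
    _ = ∫ y in Ioi 0, ∫ x in Ioi 0, signSum g (x, y) := by
        refine integral_congr_ae (ae_restrict_of_ae ?_)
        rw [Measure.volume_eq_prod] at hi₁
        filter_upwards [hi₁.prod_left_ae] with y hy
        rw [integral_eq_setIntegral_Ioi_add_neg hy]
        refine integral_congr_ae (.of_forall fun x => ?_)
        simp [signSum, hg₁]; ring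
    _ = ∫ z in quadrant, signSum g z := by
        rw [restrict_quadrant]
        refine (integral_prod_symm _ ?_).symm
        rw [← restrict_quadrant]
        exact hi₂.integrableOn

/-- The function `C x^u y^v`, cut off to the box `(0, R]²`. -/
noncomputable def boxBound (C u v R : ℝ) : ℝ × ℝ → ℝ :=
  (Ioc 0 R ×ˢ Ioc 0 R).indicator fun z => C * (z.1 ^ u * z.2 ^ v)

theorem integrable_boxBound {u v : ℝ} (C R : ℝ) (hu : -1 < u) (hv : -1 < v) :
    Integrable (boxBound C u v R) := by
  have h1 : ∀ {w : ℝ}, -1 < w → Integrable (fun x : ℝ => x ^ w) (volume.restrict (Ioc 0 R)) := by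
    intro w hw
    exact (intervalIntegral.intervalIntegrable_rpow' (a := 0) (b := R) hw).1
  rw [boxBound, integrable_indicator_iff (measurableSet_Ioc.prod measurableSet_Ioc), IntegrableOn,
    Measure.volume_eq_prod, ← Measure.prod_restrict]
  exact ((h1 hu).mul_prod (h1 hv)).const_mul C

theorem norm_le_boxBound {C u v R : ℝ} {g : ℝ × ℝ → ℂ}
    (hg : ∀ x y, 0 < x → 0 < y → x ≤ R → y ≤ R → ‖g (x, y)‖ ≤ C * (x ^ u * y ^ v))
    (hg0 : ∀ x y, 0 < x → 0 < y → ¬ (x ≤ R ∧ y ≤ R) → g (x, y) = 0) :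
    ∀ z ∈ quadrant, ‖g z‖ ≤ boxBound C u v R z := by
  rintro ⟨x, y⟩ ⟨hx, hy⟩
  have hx : 0 < x := hx
  have hy : 0 < y := hy
  by_cases h : x ≤ R ∧ y ≤ R
  · rw [boxBound, indicator_of_mem (by exact ⟨⟨hx, h.1⟩, ⟨hy, h.2⟩⟩)]
    exact hg x y hx hy h.1 h.2
  · rw [hg0 x y hx hy h, boxBound, indicator_of_notMem, norm_zero]
    rintro ⟨h1, h2⟩
    exact h ⟨h1.2, h2.2⟩

theorem setIntegral_boxBound_eq {C u v R : ℝ} (hu : -1 < u) (hv : -1 < v) (hR : 0 ≤ R) :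
    ∫ z in quadrant, boxBound C u v R z = C * (R ^ (u + 1) / (u + 1) * (R ^ (v + 1) / (v + 1))) := by
  have h1 : ∀ {w : ℝ}, -1 < w → ∫ x in Ioc 0 R, x ^ w = R ^ (w + 1) / (w + 1) := by
    intro w hw
    rw [← intervalIntegral.integral_of_le hR, integral_rpow (Or.inl hw),
      Real.zero_rpow (by linarith), sub_zero]
  have hsub : (Ioc 0 R ×ˢ Ioc 0 R : Set (ℝ × ℝ)) ⊆ quadrant := fun z hz => ⟨hz.1.1, hz.2.1⟩
  rw [boxBound, integral_indicator (measurableSet_Ioc.prod measurableSet_Ioc),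
    Measure.restrict_restrict (measurableSet_Ioc.prod measurableSet_Ioc),
    inter_eq_left.2 hsub, Measure.volume_eq_prod, ← Measure.prod_restrict, integral_const_mul,
    integral_prod_mul (fun x : ℝ => x ^ u) (fun y : ℝ => y ^ v), h1 hu, h1 hv]

/-- The partial derivative in the second variable. -/
noncomputable def partialSnd (Φ : ℝ × ℝ → ℝ) (z : ℝ × ℝ) : ℝ := fderiv ℝ Φ z (0, 1)

theorem contDiff_partialSnd {Φ : ℝ × ℝ → ℝ} (h : ContDiff ℝ (⊤ : ℕ∞) Φ) :
    ContDiff ℝ (⊤ : ℕ∞) (partialSnd Φ) :=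
  (h.fderiv_right (m := (⊤ : ℕ∞)) (by simp)).clm_apply contDiff_const

theorem hasCompactSupport_partialSnd {Φ : ℝ × ℝ → ℝ} (h : HasCompactSupport Φ) :
    HasCompactSupport (partialSnd Φ) := h.fderiv_apply (𝕜 := ℝ) (0, 1)

theorem hasDerivAt_partialSnd {Φ : ℝ × ℝ → ℝ} (h : ContDiff ℝ (⊤ : ℕ∞) Φ) (x y : ℝ) :
    HasDerivAt (fun y => Φ (x, y)) (partialSnd Φ (x, y)) y := by
  have h1 : HasFDerivAt Φ (fderiv ℝ Φ (x, y)) (x, y) :=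
    (h.differentiable (by simp) (x, y)).hasFDerivAt
  exact h1.comp_hasDerivAt y ((hasDerivAt_const y x).prodMk (hasDerivAt_id y))

theorem partialSnd_neg {Φ : ℝ × ℝ → ℝ} (h : ContDiff ℝ (⊤ : ℕ∞) Φ) {ε : ℝ}
    (hε : ∀ x y, Φ (x, -y) = ε * Φ (x, y)) (x y : ℝ) :
    partialSnd Φ (x, -y) = -ε * partialSnd Φ (x, y) := by
  have h1 : HasDerivAt (fun y => Φ (x, -y)) (partialSnd Φ (x, -y) * (-1)) y :=
    (hasDerivAt_partialSnd h x (-y)).comp y (hasDerivAt_neg y)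
  have h2 : HasDerivAt (fun y => Φ (x, -y)) (ε * partialSnd Φ (x, y)) y := by
    simp only [hε]
    exact (hasDerivAt_partialSnd h x y).const_mul ε
  linarith [h1.unique h2]

theorem contDiff_iterate_partialSnd {Φ : ℝ × ℝ → ℝ} (h : ContDiff ℝ (⊤ : ℕ∞) Φ) (N : ℕ) :
    ContDiff ℝ (⊤ : ℕ∞) (partialSnd^[N] Φ) := by
  induction N with
  | zero => exact h
  | succ n ih => rw [Function.iterate_succ_apply']; exact contDiff_partialSnd ih

theorem hasCompactSupport_iterate_partialSnd {Φ : ℝ × ℝ → ℝ} (h : HasCompactSupport Φ) (N : ℕ) :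
    HasCompactSupport (partialSnd^[N] Φ) := by
  induction N with
  | zero => exact h
  | succ n ih => rw [Function.iterate_succ_apply']; exact hasCompactSupport_partialSnd ih

theorem iterate_partialSnd_neg {Φ : ℝ × ℝ → ℝ} (h : ContDiff ℝ (⊤ : ℕ∞) Φ)
    (heven : ∀ x y, Φ (x, -y) = Φ (x, y)) (N : ℕ) (x y : ℝ) :
    partialSnd^[N] Φ (x, -y) = (-1) ^ N * partialSnd^[N] Φ (x, y) := by
  induction N generalizing x y with
  | zero => simp [heven]
  | succ n ih =>
    rw [Function.iterate_succ_apply', partialSnd_neg (contDiff_iterate_partialSnd h n) ih, pow_succ]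
    ring

theorem exists_bound_of_hasCompactSupport {Φ : ℝ × ℝ → ℝ} (h : Continuous Φ)
    (hc : HasCompactSupport Φ) :
    ∃ M R : ℝ, 0 ≤ M ∧ 1 ≤ R ∧ (∀ z, |Φ z| ≤ M) ∧
      ∀ x y, 0 < x → 0 < y → ¬ (x ≤ R ∧ y ≤ R) → Φ (x, y) = 0 := by
  obtain ⟨M, hM⟩ := hc.exists_bound_of_continuous h
  obtain ⟨R, hR⟩ := hc.isCompact.isBounded.subset_closedBall 0
  refine ⟨M, max 1 R, (norm_nonneg _).trans (hM 0), le_max_left _ _, hM, fun x y hx hy hxy => ?_⟩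
  by_contra hne
  have h1 := hR (subset_tsupport _ (Function.mem_support.2 hne))
  rw [mem_closedBall_zero_iff, Prod.norm_def, max_le_iff] at h1
  simp only [Real.norm_eq_abs, abs_of_pos hx, abs_of_pos hy] at h1
  exact hxy ⟨h1.1.trans (le_max_right _ _), h1.2.trans (le_max_right _ _)⟩

/-- An odd function of the second variable vanishes to first order on the axis. -/
theorem exists_abs_le_mul_of_odd {Φ : ℝ × ℝ → ℝ} (h : ContDiff ℝ (⊤ : ℕ∞) Φ)
    (hc : HasCompactSupport Φ) (hodd : ∀ x y, Φ (x, -y) = -Φ (x, y)) :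
    ∃ M, 0 ≤ M ∧ ∀ x y, 0 < y → |Φ (x, y)| ≤ M * y := by
  obtain ⟨M, R, hM0, -, hM, -⟩ := exists_bound_of_hasCompactSupport
    (contDiff_partialSnd h).continuous (hasCompactSupport_partialSnd hc)
  refine ⟨M, hM0, fun x y hy => ?_⟩
  have h0 : Φ (x, 0) = 0 := by have := hodd x 0; rw [neg_zero] at this; linarith
  have := convex_univ.norm_image_sub_le_of_norm_hasDerivWithin_le (f := fun y => Φ (x, y))
    (f' := fun y => partialSnd Φ (x, y)) (C := M)
    (fun y _ => (hasDerivAt_partialSnd h x y).hasDerivWithinAt) (fun y _ => hM _)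
    (mem_univ (0 : ℝ)) (mem_univ y)
  simpa [h0, abs_of_pos hy] using this

theorem contDiff_signSum {φ : ℝ × ℝ → ℝ} (h : ContDiff ℝ (⊤ : ℕ∞) φ) :
    ContDiff ℝ (⊤ : ℕ∞) (signSum φ) := by
  unfold signSum
  have h1 : ContDiff ℝ (⊤ : ℕ∞) fun z : ℝ × ℝ => (-z.1, z.2) := by fun_prop
  have h2 : ContDiff ℝ (⊤ : ℕ∞) fun z : ℝ × ℝ => (z.1, -z.2) := by fun_prop
  have h3 : ContDiff ℝ (⊤ : ℕ∞) fun z : ℝ × ℝ => (-z.1, -z.2) := by fun_prop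
  exact (h.add (h.comp h1)).add ((h.comp h2).add (h.comp h3))

theorem hasCompactSupport_signSum {φ : ℝ × ℝ → ℝ} (h : HasCompactSupport φ) :
    HasCompactSupport (signSum φ) := by
  have h1 := h.comp_homeomorph ((Homeomorph.neg ℝ).prodCongr (Homeomorph.refl ℝ))
  have h2 := h.comp_homeomorph ((Homeomorph.refl ℝ).prodCongr (Homeomorph.neg ℝ))
  have h3 := h.comp_homeomorph ((Homeomorph.neg ℝ).prodCongr (Homeomorph.neg ℝ))
  exact (h.add h1).add (h2.add h3)

theorem signSum_neg_snd (φ : ℝ × ℝ → ℝ) (x y : ℝ) : signSum φ (x, -y) = signSum φ (x, y) := by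
  simp [signSum]; ring

theorem signSum_zero (φ : ℝ × ℝ → ℝ) : signSum φ (0, 0) = 4 * φ (0, 0) := by
  simp [signSum]; ring

/-! ### The monomial zeta integral -/

/-- The kernel `(x^a y^b)^s` on the open quadrant. -/
noncomputable def monoKer (a b : ℕ) (s : ℂ) (z : ℝ × ℝ) : ℂ :=
  Complex.exp (s * ((a * Real.log z.1 + b * Real.log z.2 : ℝ) : ℂ))

theorem norm_monoKer (a b : ℕ) (s : ℂ) {x y : ℝ} (hx : 0 < x) (hy : 0 < y) :
    ‖monoKer a b s (x, y)‖ = x ^ (a * s.re) * y ^ (b * s.re) := by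
  rw [monoKer, Complex.norm_exp, Complex.re_mul_ofReal, Real.rpow_def_of_pos hx,
    Real.rpow_def_of_pos hy, ← Real.exp_add]
  ring_nf

theorem measurable_monoKer (a b : ℕ) (s : ℂ) : Measurable (monoKer a b s) := by
  unfold monoKer; fun_prop

theorem differentiable_monoKer (a b : ℕ) (z : ℝ × ℝ) : Differentiable ℂ fun s => monoKer a b s z := by
  unfold monoKer; fun_prop

/-- The monomial zeta integral `∫ (x^a y^b)^s y^N Φ` over the open quadrant. -/
noncomputable def monoZ (a b N : ℕ) (Φ : ℝ × ℝ → ℝ) (s : ℂ) : ℂ :=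
  ∫ z in quadrant, monoKer a b s z * ((z.2 ^ N * Φ z : ℝ) : ℂ)

/-- Replaces an exponent varying in `[u₀, u₁]` by the smallest one, at the price of a power of `R`,
which makes bounds uniform over vertical strips. -/
theorem rpow_le_rpow_mul {x R u₀ u₁ u : ℝ} (hx : 0 < x) (hxR : x ≤ R) (hR : 1 ≤ R) (h0 : u₀ ≤ u)
    (h1 : u ≤ u₁) : x ^ u ≤ x ^ u₀ * R ^ (u₁ - u₀) := by
  calc x ^ u = x ^ u₀ * x ^ (u - u₀) := by rw [← Real.rpow_add hx]; ring_nf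
    _ ≤ x ^ u₀ * R ^ (u - u₀) := by
      gcongr
    _ ≤ x ^ u₀ * R ^ (u₁ - u₀) := by
      gcongr

/-- The parameter `k` records the order of vanishing of `Φ` on the axis `y = 0`: `k = 0` in general,
`k = 1` for the odd derivatives that occur in the borderline case. -/
theorem norm_monoIntegrand_le {a b N k : ℕ} {Φ : ℝ × ℝ → ℝ} {M R σ₀ σ₁ : ℝ}
    (hR : 1 ≤ R) (hΦM : ∀ x y, 0 < y → |Φ (x, y)| ≤ M * y ^ k)
    (hΦR : ∀ x y, 0 < x → 0 < y → ¬ (x ≤ R ∧ y ≤ R) → Φ (x, y) = 0)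
    {s : ℂ} (h0 : σ₀ ≤ s.re) (h1 : s.re ≤ σ₁) :
    ∀ z ∈ quadrant, ‖monoKer a b s z * ((z.2 ^ N * Φ z : ℝ) : ℂ)‖ ≤
      boxBound (M * R ^ (a * σ₁ - a * σ₀) * R ^ (b * σ₁ - b * σ₀)) (a * σ₀) (b * σ₀ + N + k) R z := by
  refine norm_le_boxBound (fun x y hx hy hxR hyR => ?_) fun x y hx hy hxy => ?_
  · rw [norm_mul, norm_monoKer a b s hx hy, Complex.norm_real, Real.norm_eq_abs, abs_mul,
      abs_of_nonneg (by positivity : 0 ≤ y ^ N)]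
    have e1 := rpow_le_rpow_mul hx hxR hR (mul_le_mul_of_nonneg_left h0 a.cast_nonneg)
      (mul_le_mul_of_nonneg_left h1 a.cast_nonneg)
    have e2 := rpow_le_rpow_mul hy hyR hR (mul_le_mul_of_nonneg_left h0 b.cast_nonneg)
      (mul_le_mul_of_nonneg_left h1 b.cast_nonneg)
    calc _ ≤ (x ^ (a * σ₀) * R ^ (a * σ₁ - a * σ₀)) * (y ^ (b * σ₀) * R ^ (b * σ₁ - b * σ₀)) *
          (y ^ N * (M * y ^ k)) := by
          gcongr
          exact hΦM x y hy
      _ = _ := by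
          rw [Real.rpow_add hy, Real.rpow_add hy, Real.rpow_natCast, Real.rpow_natCast]; ring
  · simp [hΦR x y hx hy hxy]

theorem exists_neg_inv_lt_lt {a : ℕ} (ha : 0 < a) {σ : ℝ} (h : -(1 / (a : ℝ)) < σ) :
    ∃ σ₀, -(1 / (a : ℝ)) < σ₀ ∧ σ₀ < σ ∧ σ₀ ≤ 0 := by
  have h0 : -(1 / (a : ℝ)) < 0 := by
    rw [neg_lt_zero]; positivity
  obtain ⟨σ₀, h1, h2⟩ := exists_between (lt_min h h0)
  exact ⟨σ₀, h1, h2.trans_le (min_le_left _ _), h2.le.trans (min_le_right _ _)⟩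

theorem measurable_monoIntegrand {a b N : ℕ} {Φ : ℝ × ℝ → ℝ} (h : Continuous Φ) (s : ℂ) :
    Measurable fun z : ℝ × ℝ => monoKer a b s z * ((z.2 ^ N * Φ z : ℝ) : ℂ) := by
  have := h.measurable
  have := measurable_monoKer a b s
  fun_prop

theorem neg_one_lt_mul_of_neg_inv_lt {a : ℕ} (ha : 0 < a) {σ : ℝ} (h : -(1 / (a : ℝ)) < σ) :
    -1 < a * σ := by
  have ha' : (0 : ℝ) < a := by exact_mod_cast ha
  have := mul_lt_mul_of_pos_left h ha'
  rwa [mul_neg, mul_one_div_cancel ha'.ne'] at this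

/-- `N` integrations by parts suffice: `b ≤ a(N+1)` keeps the `y`-exponent integrable at `0`
throughout `Re s > -1/a`. -/
theorem neg_one_lt_mul_add_of_neg_inv_lt {a b N : ℕ} (ha : 0 < a) (hb : 0 < b)
    (hN : b ≤ a * (N + 1)) {σ : ℝ} (h : -(1 / (a : ℝ)) < σ) : -1 < b * σ + N := by
  have ha' : (0 : ℝ) < a := by exact_mod_cast ha
  have hb' : (0 : ℝ) < b := by exact_mod_cast hb
  have h1 := mul_lt_mul_of_pos_left h hb'
  have h2 : (b : ℝ) / a ≤ N + 1 := by
    rw [div_le_iff₀ ha']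
    have : (b : ℝ) ≤ a * (N + 1) := by exact_mod_cast hN
    linarith
  have h3 : (b : ℝ) * -(1 / (a : ℝ)) = -(b / a) := by ring
  linarith

section Mono

variable {a b N : ℕ} {Φ : ℝ × ℝ → ℝ}

theorem exists_dominating_monoIntegrand (ha : 0 < a) (hb : 0 < b) (hN : b ≤ a * (N + 1))
    (hΦ : Continuous Φ) (hc : HasCompactSupport Φ) {s₀ : ℂ} (hs₀ : s₀ ∈ halfPlane (-(1 / (a : ℝ)))) :
    ∃ W ∈ 𝓝 s₀, ∃ g : ℝ × ℝ → ℝ, Integrable g (volume.restrict quadrant) ∧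
      ∀ᵐ z ∂volume.restrict quadrant, ∀ s ∈ W,
        ‖monoKer a b s z * ((z.2 ^ N * Φ z : ℝ) : ℂ)‖ ≤ g z := by
  obtain ⟨M, R, -, hR, hΦM, hΦR⟩ := exists_bound_of_hasCompactSupport hΦ hc
  obtain ⟨σ₀, h1, h2, -⟩ := exists_neg_inv_lt_lt ha hs₀
  refine ⟨{s | σ₀ < s.re} ∩ {s | s.re < s₀.re + 1}, ?_, _, (integrable_boxBound
    (M * R ^ (a * (s₀.re + 1) - a * σ₀) * R ^ (b * (s₀.re + 1) - b * σ₀)) R (u := a * σ₀)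
    (v := b * σ₀ + N + (0 : ℕ)) ?_ ?_).integrableOn, ?_⟩
  · exact inter_mem ((isOpen_lt continuous_const Complex.continuous_re).mem_nhds h2)
      ((isOpen_lt Complex.continuous_re continuous_const).mem_nhds (lt_add_one s₀.re))
  · exact neg_one_lt_mul_of_neg_inv_lt ha h1
  · simpa using neg_one_lt_mul_add_of_neg_inv_lt ha hb hN h1
  · refine (ae_restrict_iff' measurableSet_quadrant).2 (.of_forall fun z hz s hs => ?_)
    exact norm_monoIntegrand_le hR (fun x y _ => by simpa using hΦM (x, y)) hΦR hs.1.le hs.2.le z hz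

theorem differentiableOn_monoZ (ha : 0 < a) (hb : 0 < b) (hN : b ≤ a * (N + 1))
    (hΦ : Continuous Φ) (hc : HasCompactSupport Φ) :
    DifferentiableOn ℂ (monoZ a b N Φ) (halfPlane (-(1 / (a : ℝ)))) :=
  differentiableOn_integral_of_locally_dominated
    (fun s => (measurable_monoIntegrand hΦ s).aestronglyMeasurable)
    (fun z => (differentiable_monoKer a b z).mul_const _)
    fun _ hs₀ => exists_dominating_monoIntegrand ha hb hN hΦ hc hs₀

/-- For `Re s > 0` the monomial integral converges for every `N`. -/
theorem integrableOn_monoIntegrand_of_re_pos (hΦ : Continuous Φ) (hc : HasCompactSupport Φ) {s : ℂ}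
    (hs : 0 < s.re) :
    IntegrableOn (fun z => monoKer a b s z * ((z.2 ^ N * Φ z : ℝ) : ℂ)) quadrant := by
  obtain ⟨M, R, -, hR, hΦM, hΦR⟩ := exists_bound_of_hasCompactSupport hΦ hc
  refine ((integrable_boxBound (M * R ^ (a * s.re - a * s.re) * R ^ (b * s.re - b * s.re)) R
    (u := a * s.re) (v := b * s.re + N + (0 : ℕ)) ?_ ?_).integrableOn).mono'
    (measurable_monoIntegrand hΦ s).aestronglyMeasurable
    ((ae_restrict_iff' measurableSet_quadrant).2 (.of_forall
      (norm_monoIntegrand_le hR (fun x y _ => by simpa using hΦM (x, y)) hΦR le_rfl le_rfl)))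
  · have : 0 ≤ a * s.re := by positivity
    linarith
  · have : 0 ≤ b * s.re + N + (0 : ℕ) := by positivity
    linarith

/-- Integrating the box majorant exactly keeps the two factors that may tend to `0` as `s → -1/a`;
they govern the growth rate there. -/
theorem norm_monoZ_le {k : ℕ} (ha : 0 < a) {M R : ℝ} (hM : 0 ≤ M)
    (hR : 1 ≤ R) (hΦM : ∀ x y, 0 < y → |Φ (x, y)| ≤ M * y ^ k)
    (hΦR : ∀ x y, 0 < x → 0 < y → ¬ (x ≤ R ∧ y ≤ R) → Φ (x, y) = 0)
    {s : ℂ} (hs : -(1 / (a : ℝ)) < s.re) (hs0 : s.re ≤ 0) (hv : 0 < b * s.re + N + k + 1) :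
    ‖monoZ a b N Φ s‖ ≤
      M * R ^ (N + k + 2) / ((a * s.re + 1) * (b * s.re + N + k + 1)) := by
  have hu : -1 < a * s.re := neg_one_lt_mul_of_neg_inv_lt ha hs
  have hu' : 0 < a * s.re + 1 := by linarith
  have h1 := norm_monoIntegrand_le (a := a) (b := b) (N := N) hR hΦM hΦR (s := s) le_rfl le_rfl
  simp only [sub_self, Real.rpow_zero, mul_one] at h1
  have h2 := norm_integral_le_of_norm_le
    (integrable_boxBound M R (v := b * s.re + N + k) hu (by linarith)).integrableOn
    ((ae_restrict_iff' measurableSet_quadrant).2 (.of_forall h1))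
  rw [setIntegral_boxBound_eq hu (by linarith) (by linarith)] at h2
  refine h2.trans ?_
  rw [div_mul_div_comm, ← mul_div_assoc, ← Real.rpow_add (by linarith)]
  gcongr
  rw [← Real.rpow_natCast]
  refine Real.rpow_le_rpow_of_exponent_le hR ?_
  have h3 : a * s.re ≤ 0 := mul_nonpos_of_nonneg_of_nonpos a.cast_nonneg hs0
  have h4 : b * s.re ≤ 0 := mul_nonpos_of_nonneg_of_nonpos b.cast_nonneg hs0
  push_cast
  linarith

/-- Integration by parts in the second variable. -/
theorem monoZ_succ (hΦ : ContDiff ℝ (⊤ : ℕ∞) Φ) (hc : HasCompactSupport Φ) {s : ℂ}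
    (hs : 0 < s.re) :
    monoZ a b N Φ s * (b * s + N + 1) = -monoZ a b (N + 1) (partialSnd Φ) s := by
  have hi₁ := (integrableOn_monoIntegrand_of_re_pos (a := a) (b := b) (N := N) hΦ.continuous hc
    hs).mul_const (b * s + N + 1)
  have hi₂ := integrableOn_monoIntegrand_of_re_pos (a := a) (b := b) (N := N + 1)
    (contDiff_partialSnd hΦ).continuous (hasCompactSupport_partialSnd hc) hs
  rw [monoZ, monoZ, ← integral_mul_const, eq_neg_iff_add_eq_zero, ← integral_add hi₁ hi₂,
    restrict_quadrant, integral_prod]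
  swap
  · rw [← restrict_quadrant]; exact hi₁.add hi₂
  have hi := hi₁.add hi₂
  rw [restrict_quadrant] at hi
  rw [integral_eq_zero_of_ae]
  filter_upwards [hi.prod_right_ae, ae_restrict_mem measurableSet_Ioi] with x hx hx0
  obtain ⟨M, R, -, hR, hΦM, hΦR⟩ := exists_bound_of_hasCompactSupport hΦ.continuous hc
  have hx0 : 0 < x := hx0
  have hker : ∀ y, 0 < y → HasDerivAt (fun y => monoKer a b s (x, y))
      (monoKer a b s (x, y) * (s * (b * (y : ℂ)⁻¹))) y := by
    intro y hy
    have h1 : HasDerivAt (fun y : ℝ => ((a * Real.log x + b * Real.log y : ℝ) : ℂ))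
        ((b * y⁻¹ : ℝ) : ℂ) y :=
      (((Real.hasDerivAt_log hy.ne').const_mul (b : ℝ)).const_add _).ofReal_comp
    have h2 := (h1.const_mul s).cexp
    refine h2.congr_deriv ?_
    simp only [monoKer]
    push_cast
    rfl
  -- The combined integrand is an exact `y`-derivative, so its integral over each fibre reduces to
  -- boundary values, which vanish at `0` and at `∞`.
  have hderiv : ∀ y ∈ Ioi (0 : ℝ), HasDerivAt
      (fun y => monoKer a b s (x, y) * ((y ^ (N + 1) * Φ (x, y) : ℝ) : ℂ))
      (monoKer a b s (x, y) * ((y ^ N * Φ (x, y) : ℝ) : ℂ) * (b * s + N + 1) +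
        monoKer a b s (x, y) * ((y ^ (N + 1) * partialSnd Φ (x, y) : ℝ) : ℂ)) y := by
    intro y hy
    have hy : 0 < y := hy
    have h1 : HasDerivAt (fun y : ℝ => ((y ^ (N + 1) * Φ (x, y) : ℝ) : ℂ)) _ y :=
      ((hasDerivAt_pow (N + 1) y).mul (hasDerivAt_partialSnd hΦ x y)).ofReal_comp
    refine ((hker y hy).mul h1).congr_deriv ?_
    have hy' : (y : ℂ) ≠ 0 := by exact_mod_cast hy.ne'
    push_cast
    field_simp
    ring_nf
  have hcont : ContinuousWithinAt
      (fun y => monoKer a b s (x, y) * ((y ^ (N + 1) * Φ (x, y) : ℝ) : ℂ)) (Ici 0) 0 := by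
    rw [ContinuousWithinAt]
    simp only [ne_eq, Nat.add_eq_zero_iff, one_ne_zero, and_false, not_false_eq_true, zero_pow,
      zero_mul, Complex.ofReal_zero, mul_zero]
    have hlim : Tendsto (fun y : ℝ => x ^ (a * s.re) * y ^ (b * s.re) * (y ^ (N + 1) * M))
        (𝓝[Ici 0] 0) (𝓝 0) := by
      have h1 : ContinuousAt (fun y : ℝ => x ^ (a * s.re) * y ^ (b * s.re) * (y ^ (N + 1) * M)) 0 :=
        ((continuousAt_const).mul (Real.continuousAt_rpow_const _ _ (Or.inr (by positivity)))).mul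
          (by fun_prop)
      have h2 := h1.tendsto
      simp only [ne_eq, Nat.add_eq_zero_iff, one_ne_zero, and_false, not_false_eq_true, zero_pow,
        zero_mul, mul_zero] at h2
      exact h2.mono_left nhdsWithin_le_nhds
    refine squeeze_zero_norm' ?_ hlim
    filter_upwards [self_mem_nhdsWithin] with y hy
    rcases (mem_Ici.1 hy).eq_or_lt with rfl | hy
    · simp
    · rw [norm_mul, norm_monoKer a b s hx0 hy, Complex.norm_real, norm_mul,
        Real.norm_of_nonneg (by positivity : 0 ≤ y ^ (N + 1))]
      gcongr
      exact hΦM _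
  have htop : Tendsto (fun y => monoKer a b s (x, y) * ((y ^ (N + 1) * Φ (x, y) : ℝ) : ℂ)) atTop
      (𝓝 0) := by
    refine tendsto_const_nhds.congr' ?_
    filter_upwards [eventually_gt_atTop R] with y hy
    rw [hΦR x y hx0 (by linarith) (fun h => by linarith [h.2])]
    simp
  have := integral_Ioi_of_hasDerivAt_of_tendsto hcont hderiv hx htop
  simpa using this

theorem monoZ_zero_mul_prod (hΦ : ContDiff ℝ (⊤ : ℕ∞) Φ) (hc : HasCompactSupport Φ) {s : ℂ}
    (hs : 0 < s.re) (N : ℕ) :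
    monoZ a b 0 Φ s * ∏ j ∈ Finset.range N, (b * s + j + 1) =
      (-1) ^ N * monoZ a b N (partialSnd^[N] Φ) s := by
  induction N with
  | zero => simp
  | succ n ih =>
    rw [Finset.prod_range_succ, ← mul_assoc, ih, mul_assoc,
      monoZ_succ (contDiff_iterate_partialSnd hΦ n) (hasCompactSupport_iterate_partialSnd hc n) hs,
      Function.iterate_succ_apply', pow_succ]
    ring

end Mono

/-! ### Holomorphy of the flat part -/

/-- The ratio `e^{-1/y^p} / x^q` of the two terms of the model function. -/
noncomputable def flatRatio (q : ℕ) (p : ℝ) (z : ℝ × ℝ) : ℝ := Real.exp (-1 / z.2 ^ p) / z.1 ^ q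

theorem flatRatio_pos (q : ℕ) (p : ℝ) {x : ℝ} (hx : 0 < x) (y : ℝ) : 0 < flatRatio q p (x, y) :=
  div_pos (Real.exp_pos _) (pow_pos hx q)

theorem measurable_flatRatio (q : ℕ) (p : ℝ) : Measurable (flatRatio q p) := by
  unfold flatRatio; fun_prop

/-- The factor `(1 + e^{-1/y^p} / x^q)^s - 1`. -/
noncomputable def flatKer (q : ℕ) (p : ℝ) (s : ℂ) (z : ℝ × ℝ) : ℂ :=
  Complex.exp (s * (Real.log (1 + flatRatio q p z) : ℂ)) - 1

theorem measurable_flatKer (q : ℕ) (p : ℝ) (s : ℂ) : Measurable (flatKer q p s) := by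
  have := measurable_flatRatio q p
  unfold flatKer; fun_prop

theorem differentiable_flatKer (q : ℕ) (p : ℝ) (z : ℝ × ℝ) :
    Differentiable ℂ fun s => flatKer q p s z := by
  unfold flatKer; fun_prop

/-- The difference between the zeta integral of the model function and that of its monomial. -/
noncomputable def flatZ (a b q : ℕ) (p : ℝ) (Φ : ℝ × ℝ → ℝ) (s : ℂ) : ℂ :=
  ∫ z in quadrant, monoKer a b s z * flatKer q p s z * (Φ z : ℂ)

theorem norm_flatKer_le {q : ℕ} {p θ : ℝ} (hθ : 0 < θ) (hθ1 : θ ≤ 1) (s : ℂ) {x : ℝ} (hx : 0 < x)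
    (y : ℝ) : ‖flatKer q p s (x, y)‖ ≤ ‖s‖ * (x ^ (-(q * θ)) * Real.exp (-θ / y ^ p) / θ) *
      max 1 (Real.exp (s.re * Real.log (1 + flatRatio q p (x, y)))) := by
  have hh := flatRatio_pos q p hx y
  have hL : 0 ≤ Real.log (1 + flatRatio q p (x, y)) := Real.log_nonneg (by linarith)
  have h1 := norm_cexp_sub_one_le (s * (Real.log (1 + flatRatio q p (x, y)) : ℂ))
  rw [Complex.re_mul_ofReal, norm_mul, Complex.norm_real, Real.norm_of_nonneg hL] at h1
  refine h1.trans ?_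
  have h2 := log_one_add_le_rpow hh.le hθ hθ1
  have h3 : flatRatio q p (x, y) ^ θ = x ^ (-(q * θ)) * Real.exp (-θ / y ^ p) := by
    rw [flatRatio, Real.div_rpow (Real.exp_pos _).le (by positivity), ← Real.exp_mul,
      Real.rpow_neg hx.le, Real.rpow_mul hx.le, Real.rpow_natCast]
    rw [div_eq_mul_inv, mul_comm]
    congr 2
    ring
  rw [h3] at h2
  gcongr

/-- The factor `e^{-θ/y^p}` absorbs the whole power of `y`, so the majorant has `y`-exponent `0`,
and the `x`-exponent drops only by `qθ`. -/
theorem norm_flatIntegrand_le {a b q : ℕ} {p θ : ℝ} {Φ : ℝ × ℝ → ℝ} {M R σ₀ σ₁ : ℝ} (hp : 0 < p)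
    (hqa : q ≤ a) (hθ : 0 < θ) (hθ1 : θ ≤ 1) (hM : 0 ≤ M) (hR : 1 ≤ R)
    (hΦM : ∀ z, |Φ z| ≤ M) (hΦR : ∀ x y, 0 < x → 0 < y → ¬ (x ≤ R ∧ y ≤ R) → Φ (x, y) = 0)
    (hσ₀ : σ₀ ≤ 0) :
    ∃ C, 0 ≤ C ∧ ∀ s : ℂ, σ₀ ≤ s.re → s.re ≤ σ₁ → ∀ z ∈ quadrant,
      ‖monoKer a b s z * flatKer q p s z * (Φ z : ℂ)‖ ≤
        boxBound (C * ‖s‖) (a * σ₀ - q * θ) 0 R z := by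
  obtain ⟨C₂, hC₂, hflat⟩ := exists_rpow_mul_exp_neg_le hp hθ (b * σ₀) R
  set C₁ : ℝ := R ^ (a * σ₁ - a * σ₀) + Real.exp (σ₁ * Real.log (2 * R ^ a)) * R ^ (0 - a * σ₀)
    with hC₁
  have hR0 : 0 < R := by linarith
  have key : ∀ σ x y, σ₀ ≤ σ → σ ≤ σ₁ → 0 < x → x ≤ R → 0 < y →
      x ^ (a * σ) * max 1 (Real.exp (σ * Real.log (1 + flatRatio q p (x, y)))) ≤
        C₁ * x ^ (a * σ₀) := by
    intro σ x y h0 h1 hx hxR hy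
    have hh := flatRatio_pos q p hx y
    have hL : 0 ≤ Real.log (1 + flatRatio q p (x, y)) := Real.log_nonneg (by linarith)
    have e1 : x ^ (a * σ) ≤ x ^ (a * σ₀) * R ^ (a * σ₁ - a * σ₀) :=
      rpow_le_rpow_mul hx hxR hR (by gcongr) (by gcongr)
    have hpos : 0 ≤ Real.exp (σ₁ * Real.log (2 * R ^ a)) * R ^ (0 - a * σ₀) := by positivity
    have hbig : x ^ (a * σ) ≤ C₁ * x ^ (a * σ₀) := by
      rw [hC₁, add_mul]
      have : 0 ≤ Real.exp (σ₁ * Real.log (2 * R ^ a)) * R ^ (0 - a * σ₀) * x ^ (a * σ₀) := by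
        positivity
      linarith
    rw [mul_max_of_nonneg _ _ (by positivity), mul_one, max_le_iff]
    refine ⟨hbig, ?_⟩
    rcases le_total σ 0 with hσ | hσ
    · refine le_trans (mul_le_of_le_one_right (by positivity) ?_) hbig
      exact Real.exp_le_one_iff.2 (mul_nonpos_of_nonpos_of_nonneg hσ hL)
    -- For `σ > 0` the factor `(1 + h)^σ` is unbounded, but `x^a (1 + h) = x^a + x^{a-q} e^{-1/y^p}
    -- ≤ 2R^a` because `q ≤ a`.
    · have e2 : a * Real.log x + Real.log (1 + flatRatio q p (x, y)) ≤ Real.log (2 * R ^ a) := by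
        rw [← Real.log_pow, ← Real.log_mul (by positivity) (by positivity)]
        refine Real.log_le_log (by positivity) ?_
        have e3 : x ^ a * flatRatio q p (x, y) = x ^ (a - q) * Real.exp (-1 / y ^ p) := by
          rw [flatRatio, ← Nat.sub_add_cancel hqa, pow_add, Nat.add_sub_cancel]
          field_simp
        have e4 : Real.exp (-1 / y ^ p) ≤ 1 :=
          Real.exp_le_one_iff.2 (div_nonpos_of_nonpos_of_nonneg (by norm_num) (by positivity))
        have e5 : x ^ (a - q) ≤ R ^ a :=
          (pow_le_pow_left₀ hx.le hxR _).trans (pow_le_pow_right₀ hR (Nat.sub_le a q))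
        have e6 : x ^ a ≤ R ^ a := pow_le_pow_left₀ hx.le hxR a
        rw [mul_add, e3]
        nlinarith [pow_pos hx (a - q)]
      have e7 : 0 ≤ Real.log (2 * R ^ a) := Real.log_nonneg (by nlinarith [one_le_pow₀ hR (n := a)])
      have e8 : (1 : ℝ) ≤ x ^ (a * σ₀) * R ^ (0 - a * σ₀) := by
        have := rpow_le_rpow_mul (u := 0) (u₁ := 0) hx hxR hR
          (mul_nonpos_of_nonneg_of_nonpos a.cast_nonneg hσ₀) le_rfl
        rwa [Real.rpow_zero] at this
      calc x ^ (a * σ) * Real.exp (σ * Real.log (1 + flatRatio q p (x, y)))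
          = Real.exp (σ * (a * Real.log x + Real.log (1 + flatRatio q p (x, y)))) := by
            rw [Real.rpow_def_of_pos hx, ← Real.exp_add]; ring_nf
        _ ≤ Real.exp (σ₁ * Real.log (2 * R ^ a)) := by
            refine Real.exp_le_exp.2 ((mul_le_mul_of_nonneg_left e2 hσ).trans ?_)
            gcongr
        _ ≤ Real.exp (σ₁ * Real.log (2 * R ^ a)) * (x ^ (a * σ₀) * R ^ (0 - a * σ₀)) :=
            le_mul_of_one_le_right (by positivity) e8
        _ ≤ _ := by
            rw [hC₁, add_mul]
            have : 0 ≤ R ^ (a * σ₁ - a * σ₀) * x ^ (a * σ₀) := by positivity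
            linarith
  refine ⟨C₁ * (C₂ * R ^ (b * σ₁ - b * σ₀)) / θ * M, by positivity, fun s h0 h1 =>
    norm_le_boxBound (fun x y hx hy hxR hyR => ?_) fun x y hx hy hxy => ?_⟩
  · rw [norm_mul, norm_mul, norm_monoKer a b s hx hy, Complex.norm_real, Real.norm_eq_abs]
    have e2 : y ^ (b * s.re) ≤ y ^ (b * σ₀) * R ^ (b * σ₁ - b * σ₀) :=
      rpow_le_rpow_mul hy hyR hR (by gcongr) (by gcongr)
    have e3 := hflat y hy hyR
    have e4 := key s.re x y h0 h1 hx hxR hy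
    set m := max 1 (Real.exp (s.re * Real.log (1 + flatRatio q p (x, y))))
    have hm : 0 ≤ m := le_max_of_le_left zero_le_one
    calc _ ≤ x ^ (a * s.re) * (y ^ (b * σ₀) * R ^ (b * σ₁ - b * σ₀)) *
          (‖s‖ * (x ^ (-(q * θ)) * Real.exp (-θ / y ^ p) / θ) * m) * M := by
          gcongr
          · exact norm_flatKer_le hθ hθ1 s hx y
          · exact hΦM _
      _ = (x ^ (a * s.re) * m) * (y ^ (b * σ₀) * Real.exp (-θ / y ^ p)) *
          (R ^ (b * σ₁ - b * σ₀) * (‖s‖ * x ^ (-(q * θ)) / θ) * M) := by ring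
      _ ≤ (C₁ * x ^ (a * σ₀)) * C₂ *
          (R ^ (b * σ₁ - b * σ₀) * (‖s‖ * x ^ (-(q * θ)) / θ) * M) := by
          gcongr
      _ = _ := by
          rw [Real.rpow_zero, sub_eq_add_neg (a * σ₀), Real.rpow_add hx]; ring
  · simp [hΦR x y hx hy hxy]

theorem measurable_flatIntegrand {a b q : ℕ} {p : ℝ} {Φ : ℝ × ℝ → ℝ} (h : Continuous Φ) (s : ℂ) :
    Measurable fun z : ℝ × ℝ => monoKer a b s z * flatKer q p s z * (Φ z : ℂ) := by
  have := h.measurable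
  have := measurable_monoKer a b s
  have := measurable_flatKer q p s
  fun_prop

section Flat

variable {a b q : ℕ} {p : ℝ} {Φ : ℝ × ℝ → ℝ}

theorem exists_dominating_flatIntegrand (ha : 0 < a) (hp : 0 < p) (hq : 0 < q) (hqa : q ≤ a)
    (hΦ : Continuous Φ) (hc : HasCompactSupport Φ) {s₀ : ℂ} (hs₀ : s₀ ∈ halfPlane (-(1 / (a : ℝ)))) :
    ∃ W ∈ 𝓝 s₀, ∃ g : ℝ × ℝ → ℝ, Integrable g (volume.restrict quadrant) ∧
      ∀ᵐ z ∂volume.restrict quadrant, ∀ s ∈ W,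
        ‖monoKer a b s z * flatKer q p s z * (Φ z : ℂ)‖ ≤ g z := by
  obtain ⟨M, R, hM, hR, hΦM, hΦR⟩ := exists_bound_of_hasCompactSupport hΦ hc
  obtain ⟨σ₀, h1, h2, h3⟩ := exists_neg_inv_lt_lt ha hs₀
  have h4 := neg_one_lt_mul_of_neg_inv_lt ha h1
  have hq' : (0 : ℝ) < q := by exact_mod_cast hq
  -- Half of the room `aσ₀ + 1 > 0` is spent on `qθ`, so that `aσ₀ - qθ > -1`.
  set θ : ℝ := min 1 ((a * σ₀ + 1) / (2 * q)) with hθ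
  have hθ0 : 0 < θ := lt_min one_pos (div_pos (by linarith) (by positivity))
  have hθ2 : q * θ ≤ (a * σ₀ + 1) / 2 := by
    have := min_le_right 1 ((a * σ₀ + 1) / (2 * q))
    rw [← hθ, le_div_iff₀ (by positivity)] at this
    linarith
  obtain ⟨C, hC, hbound⟩ := norm_flatIntegrand_le (b := b) (σ₁ := |s₀.re| + 1) hp hqa hθ0
    (min_le_left _ _) hM hR hΦM hΦR h3
  refine ⟨{s | σ₀ < s.re} ∩ ({s | s.re < |s₀.re| + 1} ∩ {s | ‖s‖ < ‖s₀‖ + 1}), ?_, _,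
    (integrable_boxBound (C * (‖s₀‖ + 1)) R (u := a * σ₀ - q * θ) (v := 0) (by linarith)
      (by norm_num)).integrableOn, ?_⟩
  · refine inter_mem ((isOpen_lt continuous_const Complex.continuous_re).mem_nhds h2)
      (inter_mem ((isOpen_lt Complex.continuous_re continuous_const).mem_nhds ?_)
        ((isOpen_lt continuous_norm continuous_const).mem_nhds (lt_add_one ‖s₀‖)))
    exact (le_abs_self s₀.re).trans_lt (lt_add_one |s₀.re|)
  · refine (ae_restrict_iff' measurableSet_quadrant).2 (.of_forall fun z hz s hs => ?_)
    refine (hbound s hs.1.le hs.2.1.le z hz).trans ?_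
    have : ‖s‖ ≤ ‖s₀‖ + 1 := le_of_lt hs.2.2
    rw [boxBound, boxBound]
    refine indicator_le_indicator' fun hz' => ?_
    have hz1 : 0 < z.1 := hz.1
    have hz2 : 0 < z.2 := hz.2
    gcongr

theorem integrableOn_flatIntegrand (ha : 0 < a) (hp : 0 < p) (hq : 0 < q) (hqa : q ≤ a)
    (hΦ : Continuous Φ) (hc : HasCompactSupport Φ) {s : ℂ} (hs : s ∈ halfPlane (-(1 / (a : ℝ)))) :
    IntegrableOn (fun z => monoKer a b s z * flatKer q p s z * (Φ z : ℂ)) quadrant := by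
  obtain ⟨W, hW, g, hg, hle⟩ := exists_dominating_flatIntegrand (b := b) ha hp hq hqa hΦ hc hs
  exact hg.mono' (measurable_flatIntegrand hΦ s).aestronglyMeasurable
    (hle.mono fun z hz => hz s (mem_of_mem_nhds hW))

theorem differentiableOn_flatZ (ha : 0 < a) (hp : 0 < p) (hq : 0 < q) (hqa : q ≤ a)
    (hΦ : Continuous Φ) (hc : HasCompactSupport Φ) :
    DifferentiableOn ℂ (flatZ a b q p Φ) (halfPlane (-(1 / (a : ℝ)))) :=
  differentiableOn_integral_of_locally_dominated
    (fun s => (measurable_flatIntegrand hΦ s).aestronglyMeasurable)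
    (fun z => ((differentiable_monoKer a b z).mul (differentiable_flatKer q p z)).mul_const _)
    fun _ hs₀ => exists_dominating_flatIntegrand ha hp hq hqa hΦ hc hs₀

end Flat

/-! ### Splitting the zeta integral into monomial and flat parts -/

theorem flatExp_neg (p y : ℝ) : flatExp p (-y) = flatExp p y := by
  simp [flatExp]

theorem flatExp_nonneg (p y : ℝ) : 0 ≤ flatExp p y := by
  unfold flatExp; split_ifs <;> positivity

theorem flatExp_le_one (p y : ℝ) : flatExp p y ≤ 1 := by
  unfold flatExp
  split_ifs
  · norm_num
  · exact Real.exp_le_one_iff.2 (div_nonpos_of_nonpos_of_nonneg (by norm_num) (by positivity))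

theorem measurable_flatExp (p : ℝ) : Measurable (flatExp p) :=
  Measurable.ite (measurableSet_singleton 0) measurable_const (by fun_prop)

section Model

variable {a b q : ℕ} {p : ℝ}

theorem abs_modelFun (hqe : Even q) (hqa : q ≤ a) (z : ℝ × ℝ) :
    |modelFun a b q p z| = |z.1| ^ (a - q) * |z.2| ^ b * (|z.1| ^ q + flatExp p z.2) := by
  have h1 : modelFun a b q p z = z.1 ^ (a - q) * z.2 ^ b * (z.1 ^ q + flatExp p z.2) := by
    rw [modelFun]
    nth_rewrite 1 [← Nat.sub_add_cancel hqa]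
    rw [pow_add]
    ring
  rw [h1, abs_mul, abs_mul, abs_pow, abs_pow, hqe.pow_abs,
    abs_of_nonneg (add_nonneg (hqe.pow_nonneg z.1) (flatExp_nonneg p z.2))]

theorem measurable_modelFun : Measurable (modelFun a b q p) := by
  have := measurable_flatExp p
  unfold modelFun; fun_prop

theorem integrable_zetaIntegrand (hqe : Even q) (hqa : q ≤ a) {φ : ℝ × ℝ → ℝ} (hφ : Continuous φ)
    (hc : HasCompactSupport φ) {s : ℂ} (hs : 0 < s.re) :
    Integrable fun z : ℝ × ℝ => ((|modelFun a b q p z| : ℝ) : ℂ) ^ s * ((φ z : ℝ) : ℂ) := by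
  have hcont : Continuous fun z : ℝ × ℝ =>
      (|z.1| ^ (a - q) * |z.2| ^ b * (|z.1| ^ q + 1)) ^ s.re * |φ z| :=
    ((by fun_prop : Continuous fun z : ℝ × ℝ =>
      |z.1| ^ (a - q) * |z.2| ^ b * (|z.1| ^ q + 1)).rpow_const fun _ => Or.inr hs.le).mul hφ.abs
  refine (hcont.integrable_of_hasCompactSupport ?_).mono' ?_ (.of_forall fun z => ?_)
  · exact (hc.comp_left (g := fun t : ℝ => |t|) abs_zero).mul_left
  · have h1 := measurable_modelFun (a := a) (b := b) (q := q) (p := p)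
    have h2 := hφ.measurable
    exact Measurable.aestronglyMeasurable (by fun_prop)
  · rw [norm_mul, Complex.norm_real, Real.norm_eq_abs]
    gcongr
    rw [Complex.norm_cpow_eq_rpow_re_of_nonneg (abs_nonneg _) hs.ne', abs_modelFun hqe hqa]
    have := flatExp_nonneg p z.2
    have := flatExp_le_one p z.2
    gcongr

theorem abs_modelFun_cpow (hqe : Even q) (hqa : q ≤ a) (s : ℂ) {x y : ℝ}
    (hx : 0 < x) (hy : 0 < y) :
    ((|modelFun a b q p (x, y)| : ℝ) : ℂ) ^ s =
      monoKer a b s (x, y) + monoKer a b s (x, y) * flatKer q p s (x, y) := by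
  have hh := flatRatio_pos q p hx y
  have h1 : |modelFun a b q p (x, y)| = x ^ a * y ^ b * (1 + flatRatio q p (x, y)) := by
    rw [abs_modelFun hqe hqa]
    simp only [abs_of_pos hx, abs_of_pos hy]
    rw [flatExp, if_neg hy.ne', abs_of_pos hy, flatRatio]
    have h0 : x ^ a = x ^ (a - q) * x ^ q := by rw [← pow_add, Nat.sub_add_cancel hqa]
    simp only [h0]
    field_simp
  have hpos : 0 < x ^ a * y ^ b * (1 + flatRatio q p (x, y)) := by positivity
  rw [h1, Complex.cpow_def_of_ne_zero (by exact_mod_cast hpos.ne'), ← Complex.ofReal_log hpos.le,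
    Real.log_mul (by positivity) (by positivity), Real.log_mul (by positivity) (by positivity),
    Real.log_pow, Real.log_pow, monoKer, flatKer, mul_sub, ← Complex.exp_add]
  push_cast
  ring_nf

theorem Z_modelFun_eq (ha : 0 < a) (hp : 0 < p) (hq : 0 < q) (hqe : Even q) (hqa : q ≤ a)
    {φ : ℝ × ℝ → ℝ} (hφ : ContDiff ℝ (⊤ : ℕ∞) φ) (hc : HasCompactSupport φ) {s : ℂ}
    (hs : 0 < s.re) :
    Z (modelFun a b q p) φ s = monoZ a b 0 (signSum φ) s + flatZ a b q p (signSum φ) s := by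
  have hs' : s ∈ halfPlane (-(1 / (a : ℝ))) := by
    have : -(1 / (a : ℝ)) < 0 := by rw [neg_lt_zero]; positivity
    exact this.trans hs
  have hΦ := (contDiff_signSum hφ).continuous
  have hΦc := hasCompactSupport_signSum hc
  rw [Z, integral_eq_setIntegral_quadrant (integrable_zetaIntegrand hqe hqa hφ.continuous hc hs),
    monoZ, flatZ, ← integral_add (integrableOn_monoIntegrand_of_re_pos hΦ hΦc hs)
      (integrableOn_flatIntegrand ha hp hq hqa hΦ hΦc hs')]
  refine setIntegral_congr_fun measurableSet_quadrant fun z hz => ?_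
  obtain ⟨x, y⟩ := z
  have hx : 0 < x := hz.1
  have hy : 0 < y := hz.2
  have h1 : ∀ x' y' : ℝ, |x'| = |x| → |y'| = |y| →
      |modelFun a b q p (x', y')| = |modelFun a b q p (x, y)| := by
    intro x' y' h1 h2
    rw [abs_modelFun hqe hqa, abs_modelFun hqe hqa]
    simp only [h1, h2]
    rcases abs_eq_abs.1 h2 with rfl | rfl <;> simp [flatExp_neg]
  have h2 := abs_modelFun_cpow (b := b) (p := p) hqe hqa s hx hy
  simp only [signSum, h1 (-x) y (abs_neg x) rfl, h1 x (-y) rfl (abs_neg y),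
    h1 (-x) (-y) (abs_neg x) (abs_neg y), h2]
  push_cast
  ring

end Model

/-! ### Dominated convergence for the rescaled integral -/

theorem abs_one_add_rpow_sub_one_le {σ Y : ℝ} (h0 : σ ≤ 0) (h1 : -1 ≤ σ) (hY : 0 ≤ Y) :
    |(1 + Y) ^ σ - 1| ≤ min 1 Y := by
  have e1 : (1 + Y) ^ σ ≤ 1 := Real.rpow_le_one_of_one_le_of_nonpos (by linarith) h0
  have e2 : 0 ≤ (1 + Y) ^ σ := by positivity
  have e3 : (1 + Y) ^ (-1 : ℝ) ≤ (1 + Y) ^ σ :=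
    Real.rpow_le_rpow_of_exponent_le (by linarith) h1
  have e4 : 1 - Y ≤ (1 + Y) ^ (-1 : ℝ) := by
    rw [Real.rpow_neg_one, ← one_div, le_div_iff₀ (by linarith)]
    nlinarith
  rw [abs_sub_comm, abs_of_nonneg (by linarith)]
  exact le_min (by linarith) (by linarith)

theorem min_one_rpow_le {X r : ℝ} (hX : 0 < X) (hr : 1 ≤ r) : min 1 (X ^ r) ≤ min 1 X := by
  rcases le_total X 1 with h | h
  · refine min_le_min_left 1 ?_
    simpa using Real.rpow_le_rpow_of_exponent_ge hX h hr
  · rw [min_eq_left h]; exact min_le_left _ _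

theorem min_one_le_rpow {X r : ℝ} (hX : 0 < X) (h0 : 0 ≤ r) (hr : r ≤ 1) : min 1 X ≤ X ^ r := by
  rcases le_total X 1 with h | h
  · rw [min_eq_right h]
    simpa using Real.rpow_le_rpow_of_exponent_ge hX h hr
  · rw [min_eq_left h]; exact Real.one_le_rpow h h0

/-- A function integrable on `(0, ∞)` that dominates the `x`-dependence after rescaling. -/
noncomputable def scaleMajorant (t : ℝ) : ℝ := if t ≤ 1 then t ^ (-(1 / 2) : ℝ) else t ^ (-2 : ℝ)

theorem integrableOn_scaleMajorant : IntegrableOn scaleMajorant (Ioi 0) := by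
  rw [← Ioc_union_Ioi_eq_Ioi (zero_le_one' ℝ)]
  refine IntegrableOn.union ?_ ?_
  · refine IntegrableOn.congr_fun (intervalIntegral.intervalIntegrable_rpow' (a := 0) (b := 1)
      (by norm_num : (-1 : ℝ) < -(1 / 2))).1 (fun t ht => ?_) measurableSet_Ioc
    simp [scaleMajorant, ht.2]
  · refine IntegrableOn.congr_fun (integrableOn_Ioi_rpow_of_lt (by norm_num : (-2 : ℝ) < -1)
      one_pos) (fun t ht => ?_) measurableSet_Ioi
    rw [scaleMajorant, if_neg (not_le.2 ht)]

theorem scaleMajorant_nonneg {t : ℝ} (ht : 0 < t) : 0 ≤ scaleMajorant t := by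
  unfold scaleMajorant; split_ifs <;> positivity

theorem flatRatio_rpow {q : ℕ} {p : ℝ} {t : ℝ} (ht : 0 < t) (v r : ℝ) :
    flatRatio q p (t, v) ^ r = Real.exp (-r / v ^ p) * t ^ (-(q * r)) := by
  rw [flatRatio, Real.div_rpow (Real.exp_pos _).le (by positivity), ← Real.exp_mul,
    Real.rpow_neg ht.le, Real.rpow_mul ht.le, Real.rpow_natCast, div_eq_mul_inv]
  congr 2
  ring

/-- For `t ≤ 1` the power `1/(2q)` of the ratio bounds the minimum and yields `t^{-1/2}`; for `t >
1` the ratio itself decays like `t^{-q} ≤ t^{-2}`. The weaker exponential serves both ranges. -/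
theorem min_one_flatRatio_le {q : ℕ} {p : ℝ} (hq : 2 ≤ q) {t v : ℝ} (ht : 0 < t) (hv : 0 < v) :
    min 1 (flatRatio q p (t, v)) ≤ Real.exp (-(1 / (2 * q)) / v ^ p) * scaleMajorant t := by
  have hX := flatRatio_pos q p ht v
  have hq' : (2 : ℝ) ≤ q := by exact_mod_cast hq
  have hr1 : 1 / (2 * (q : ℝ)) ≤ 1 := by rw [div_le_one (by positivity)]; linarith
  rw [scaleMajorant]
  split_ifs with h
  · refine (min_one_le_rpow hX (by positivity : 0 ≤ 1 / (2 * (q : ℝ))) hr1).trans (le_of_eq ?_)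
    rw [flatRatio_rpow ht]
    congr 3
    field_simp
  · have h1 : 1 < t := not_le.1 h
    refine (min_le_right _ _).trans ?_
    have h2 := flatRatio_rpow (q := q) (p := p) ht v 1
    rw [Real.rpow_one] at h2
    rw [h2]
    have hvp : 0 < v ^ p := by positivity
    gcongr
    · exact h1.le
    · linarith

/-- Flatness handles `v → 0` and `c > 1` handles `v → ∞`; applied with exponents made from `b/a`,
this is where `b/a > 1` matters. -/
theorem integrableOn_rpow_mul_exp {p θ c : ℝ} (hp : 0 < p) (hθ : 0 < θ) (hc : 1 < c) :
    IntegrableOn (fun v : ℝ => v ^ (-c) * Real.exp (-θ / v ^ p)) (Ioi 0) := by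
  have hm : ∀ s : Set ℝ, AEStronglyMeasurable (fun v : ℝ => v ^ (-c) * Real.exp (-θ / v ^ p))
      (volume.restrict s) := fun s => Measurable.aestronglyMeasurable (by fun_prop)
  rw [← Ioc_union_Ioi_eq_Ioi (zero_le_one' ℝ)]
  refine IntegrableOn.union ?_ ?_
  · obtain ⟨C, hC, h⟩ := exists_rpow_mul_exp_neg_le hp hθ (-c) 1
    refine Integrable.mono' (g := fun _ => C) (integrableOn_const (by simp)) (hm _)
      ((ae_restrict_iff' measurableSet_Ioc).2 (.of_forall fun v hv => ?_))
    have hv0 : 0 < v := hv.1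
    rw [Real.norm_of_nonneg (by positivity)]
    exact h v hv.1 hv.2
  · refine Integrable.mono' (integrableOn_Ioi_rpow_of_lt (by linarith : -c < -1) one_pos) (hm _)
      ((ae_restrict_iff' measurableSet_Ioi).2 (.of_forall fun v hv => ?_))
    have hv0 : 0 < v := one_pos.trans hv
    rw [Real.norm_of_nonneg (by positivity)]
    refine mul_le_of_le_one_right (by positivity) (Real.exp_le_one_iff.2 ?_)
    exact div_nonpos_of_nonpos_of_nonneg (by linarith) (by positivity)

theorem rpow_le_rpow_add_rpow {v u₀ u u₁ : ℝ} (hv : 0 < v) (h0 : u₀ ≤ u) (h1 : u ≤ u₁) :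
    v ^ u ≤ v ^ u₀ + v ^ u₁ := by
  have e0 : 0 < v ^ u₀ := by positivity
  have e1 : 0 < v ^ u₁ := by positivity
  rcases le_total v 1 with h | h
  · linarith [Real.rpow_le_rpow_of_exponent_ge hv h h0]
  · linarith [Real.rpow_le_rpow_of_exponent_le h h1]

/-- The integrand of `flatZ` at `s = (δ - 1) / a` after the substitution `x = t^{1/δ}`,
`y = δ^{1/p} v`. -/
noncomputable def scaledIntegrand (a b q : ℕ) (p : ℝ) (Φ : ℝ × ℝ → ℝ) (δ : ℝ) (z : ℝ × ℝ) : ℝ :=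
  z.2 ^ (b / a * (δ - 1)) * (((1 + flatRatio q p z ^ δ⁻¹) ^ ((δ - 1) / a) - 1) *
    Φ (z.1 ^ δ⁻¹, δ ^ p⁻¹ * z.2))

theorem measurable_scaledIntegrand {a b q : ℕ} {p : ℝ} {Φ : ℝ × ℝ → ℝ} (hΦ : Continuous Φ) (δ : ℝ) :
    Measurable (scaledIntegrand a b q p Φ δ) := by
  have := hΦ.measurable
  have := measurable_flatRatio q p
  unfold scaledIntegrand; fun_prop

section Scaling

variable {a b q : ℕ} {p : ℝ} {Φ : ℝ × ℝ → ℝ}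

/-- The majorant used for dominated convergence in the rescaled integral. -/
noncomputable def scaledBound (a b q : ℕ) (p M : ℝ) (z : ℝ × ℝ) : ℝ :=
  M * (scaleMajorant z.1 * ((z.2 ^ (-(b / a : ℝ)) + z.2 ^ (-((1 + b / a) / 2 : ℝ))) *
    Real.exp (-(1 / (2 * q)) / z.2 ^ p)))

theorem integrable_scaledBound (hp : 0 < p) (hq : 0 < q) (hab : 1 < (b / a : ℝ)) (M : ℝ) :
    IntegrableOn (scaledBound a b q p M) quadrant := by
  rw [IntegrableOn, restrict_quadrant]
  have hθ : 0 < 1 / (2 * (q : ℝ)) := by positivity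
  have h1 := integrableOn_rpow_mul_exp hp hθ hab
  have h2 := integrableOn_rpow_mul_exp hp hθ (by linarith : 1 < (1 + b / a : ℝ) / 2)
  refine ((integrableOn_scaleMajorant.integrable).mul_prod
    (g := fun v : ℝ => (v ^ (-(b / a : ℝ)) + v ^ (-((1 + b / a) / 2 : ℝ))) *
      Real.exp (-(1 / (2 * q)) / v ^ p)) ?_).const_mul M
  refine (h1.add h2).congr (.of_forall fun v => ?_)
  simp only [Pi.add_apply]
  ring

/-- With `β = b/a`, the bound on `δ` says `β(1 - δ) ≥ (1 + β)/2 > 1`, so the `v`-exponent stays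
between two values integrable at infinity. Uniformity in `δ` of the other factor comes from `min(1,
X^{1/δ}) ≤ min(1, X)`. -/
theorem abs_scaledIntegrand_le (ha : 0 < a) (hq : 2 ≤ q) (hab : 1 < (b / a : ℝ)) {M : ℝ}
    (hΦM : ∀ z, |Φ z| ≤ M) {δ : ℝ} (hδ : 0 < δ)
    (hδ1 : δ ≤ ((b / a : ℝ) - 1) / (2 * (b / a))) {z : ℝ × ℝ} (hz : z ∈ quadrant) :
    |scaledIntegrand a b q p Φ δ z| ≤ scaledBound a b q p M z := by
  obtain ⟨t, v⟩ := z
  have ht : 0 < t := hz.1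
  have hv : 0 < v := hz.2
  set β : ℝ := b / a with hβ
  have hX := flatRatio_pos q p ht v
  have hδ2 : δ * (2 * β) ≤ β - 1 := by rwa [le_div_iff₀ (by positivity)] at hδ1
  have hδ3 : δ ≤ 1 := by nlinarith
  have ha' : (1 : ℝ) ≤ a := by exact_mod_cast ha
  have h1 : |(1 + flatRatio q p (t, v) ^ δ⁻¹) ^ ((δ - 1) / a) - 1| ≤
      Real.exp (-(1 / (2 * q)) / v ^ p) * scaleMajorant t := by
    refine (abs_one_add_rpow_sub_one_le ?_ ?_ (by positivity)).trans
      ((min_one_rpow_le hX ((one_le_inv₀ hδ).2 hδ3)).trans (min_one_flatRatio_le hq ht hv))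
    · exact div_nonpos_of_nonpos_of_nonneg (by linarith) (by positivity)
    · rw [le_div_iff₀ (by positivity)]; linarith
  have h2 : v ^ (β * (δ - 1)) ≤ v ^ (-β) + v ^ (-((1 + β) / 2)) :=
    rpow_le_rpow_add_rpow hv (by nlinarith) (by nlinarith)
  have := scaleMajorant_nonneg ht
  rw [scaledIntegrand, scaledBound, abs_mul, abs_mul, abs_of_nonneg (by positivity)]
  calc _ ≤ (v ^ (-β) + v ^ (-((1 + β) / 2))) *
        ((Real.exp (-(1 / (2 * q)) / v ^ p) * scaleMajorant t) * M) := by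
        gcongr
        exact hΦM _
    _ = _ := by ring

/-- The limit profile of the rescaled integrand, up to the factor `-Φ(0, 0)`. -/
noncomputable def scaledLimit (a b q : ℕ) (p : ℝ) (z : ℝ × ℝ) : ℝ :=
  {z | 1 < flatRatio q p z}.indicator (fun z => z.2 ^ (-(b / a : ℝ))) z

theorem scaledLimit_of_one_lt {z : ℝ × ℝ} (h : 1 < flatRatio q p z) :
    scaledLimit a b q p z = z.2 ^ (-(b / a : ℝ)) :=
  indicator_of_mem (s := {z | 1 < flatRatio q p z}) h _

theorem scaledLimit_of_le_one {z : ℝ × ℝ} (h : flatRatio q p z ≤ 1) :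
    scaledLimit a b q p z = 0 :=
  indicator_of_notMem (s := {z | 1 < flatRatio q p z}) (not_lt.2 h) _

/-- The level set is null by Fubini: for fixed `t`, injectivity of `exp` and of `v ↦ v^p` leaves at
most one `v`. -/
theorem ae_flatRatio_ne_one (hp : 0 < p) :
    ∀ᵐ z ∂volume.restrict quadrant, flatRatio q p z ≠ 1 := by
  have hmeas : MeasurableSet {z : ℝ × ℝ | flatRatio q p z = 1} :=
    measurable_flatRatio q p (measurableSet_singleton 1)
  rw [ae_iff]
  simp only [ne_eq, not_not]
  rw [restrict_quadrant, Measure.measure_prod_null hmeas]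
  filter_upwards [ae_restrict_mem measurableSet_Ioi] with t ht
  have ht : 0 < t := ht
  rw [Measure.restrict_apply (measurable_prodMk_left hmeas)]
  refine Set.Subsingleton.measure_zero ?_ _
  rintro v ⟨hv, hv0⟩ w ⟨hw, hw0⟩
  have hv0 : 0 < v := hv0
  have hw0 : 0 < w := hw0
  have hv : flatRatio q p (t, v) = 1 := hv
  have hw : flatRatio q p (t, w) = 1 := hw
  rw [← hw, flatRatio, flatRatio, div_left_inj' (by positivity), Real.exp_eq_exp,
    div_eq_div_iff (by positivity) (by positivity)] at hv
  have h1 : v ^ p = w ^ p := by simp only at hv; linarith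
  exact (Real.rpow_left_inj hv0.le hw0.le hp.ne').1 h1

/-- As `1/δ → ∞`, `X^{1/δ}` tends to `0` or `∞` according as `X < 1` or `X > 1`, so the bracket
tends to `0` or to `-1`. -/
theorem tendsto_scaledIntegrand (ha : 0 < a) (hp : 0 < p) (hΦ : Continuous Φ)
    {M : ℝ} (hΦM : ∀ z, |Φ z| ≤ M) {z : ℝ × ℝ} (hz : z ∈ quadrant) (hz1 : flatRatio q p z ≠ 1) :
    Tendsto (fun δ => scaledIntegrand a b q p Φ δ z) (𝓝[>] 0)
      (𝓝 (-Φ (0, 0) * scaledLimit a b q p z)) := by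
  obtain ⟨t, v⟩ := z
  have ht : 0 < t := hz.1
  have hv : 0 < v := hz.2
  have hX := flatRatio_pos q p ht v
  have hid : Tendsto (fun δ : ℝ => δ) (𝓝[>] 0) (𝓝 0) := tendsto_id.mono_left nhdsWithin_le_nhds
  have hinv : Tendsto (fun δ : ℝ => δ⁻¹) (𝓝[>] 0) atTop := tendsto_inv_nhdsGT_zero
  have hpow : ∀ c : ℝ, 0 < c → c < 1 → Tendsto (fun δ : ℝ => c ^ δ⁻¹) (𝓝[>] 0) (𝓝 0) :=
    fun c h0 h1 => (tendsto_rpow_atTop_of_base_lt_one c (by linarith) h1).comp hinv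
  have hvlim : Tendsto (fun δ : ℝ => v ^ ((b : ℝ) / a * (δ - 1))) (𝓝[>] 0) (𝓝 (v ^ (-(b / a : ℝ)))) := by
    have h := (Real.continuousAt_const_rpow hv.ne' (b := (b : ℝ) / a * (0 - 1))).tendsto.comp
      ((hid.sub_const 1).const_mul ((b : ℝ) / a))
    simpa [Function.comp_def] using h
  have ha' : (0 : ℝ) < a := by exact_mod_cast ha
  rcases lt_or_gt_of_ne hz1 with hlt | hgt
  · rw [scaledLimit_of_le_one hlt.le, mul_zero]
    have hb := (hvlim.mul (hpow _ hX hlt)).mul_const M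
    simp only [mul_zero, zero_mul] at hb
    refine squeeze_zero_norm' ?_ hb
    filter_upwards [Ioo_mem_nhdsGT (zero_lt_one' ℝ)] with δ hδ
    rw [scaledIntegrand, norm_mul, norm_mul, Real.norm_of_nonneg (by positivity), mul_assoc]
    have h1 : |(1 + flatRatio q p (t, v) ^ δ⁻¹) ^ ((δ - 1) / a) - 1| ≤ flatRatio q p (t, v) ^ δ⁻¹ := by
      refine (abs_one_add_rpow_sub_one_le ?_ ?_ (by positivity)).trans (min_le_right _ _)
      · exact div_nonpos_of_nonpos_of_nonneg (by linarith [hδ.2]) (by positivity)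
      · have : (1 : ℝ) ≤ a := by exact_mod_cast ha
        rw [le_div_iff₀ (by positivity)]; linarith [hδ.1]
    gcongr
    · exact h1
    · exact hΦM _
  · rw [scaledLimit_of_one_lt hgt]
    -- Where the ratio exceeds `1`, `t^q < e^{-1/v^p} ≤ 1`; hence `t^{1/δ} → 0` and `Φ` is evaluated
    -- ever closer to the origin.
    have ht1 : t < 1 := by
      by_contra hcon
      rw [not_lt] at hcon
      have h1 : Real.exp (-1 / v ^ p) ≤ 1 :=
        Real.exp_le_one_iff.2 (div_nonpos_of_nonpos_of_nonneg (by norm_num) (by positivity))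
      have h2 : flatRatio q p (t, v) ≤ 1 := by
        rw [flatRatio, div_le_one (by positivity)]
        exact h1.trans (one_le_pow₀ hcon)
      linarith [show 1 < flatRatio q p (t, v) from hgt]
    have hΦlim : Tendsto (fun δ : ℝ => Φ (t ^ δ⁻¹, δ ^ p⁻¹ * v)) (𝓝[>] 0) (𝓝 (Φ (0, 0))) := by
      refine (hΦ.tendsto (0, 0)).comp ((hpow t ht ht1).prodMk_nhds ?_)
      have h1 : Tendsto (fun δ : ℝ => δ ^ p⁻¹) (𝓝[>] 0) (𝓝 (0 ^ p⁻¹)) :=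
        ((Real.continuousAt_rpow_const 0 p⁻¹ (Or.inr (by positivity))).tendsto).comp hid
      rw [Real.zero_rpow (by positivity)] at h1
      simpa using h1.mul_const v
    have hrlim : Tendsto (fun δ : ℝ => (1 + flatRatio q p (t, v) ^ δ⁻¹) ^ ((δ - 1) / a)) (𝓝[>] 0)
        (𝓝 0) := by
      have hgt : 1 < flatRatio q p (t, v) := hgt
      -- For `δ < 1/2` the exponent `(δ - 1)/a` is below `-1/(2a)`.
      have hc1 : flatRatio q p (t, v) ^ (-(1 / (2 * a)) : ℝ) < 1 :=
        Real.rpow_lt_one_of_one_lt_of_neg hgt (by rw [neg_lt_zero]; positivity)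
      refine squeeze_zero' (.of_forall fun δ => by positivity) ?_ (hpow _ (by positivity) hc1)
      filter_upwards [Ioo_mem_nhdsGT (by norm_num : (0 : ℝ) < 1 / 2)] with δ hδ
      have hδ0 : 0 < δ := hδ.1
      have h1 : 1 ≤ flatRatio q p (t, v) ^ δ⁻¹ := Real.one_le_rpow hgt.le (by positivity)
      rw [← Real.rpow_mul hX.le, mul_comm, Real.rpow_mul hX.le]
      calc (1 + flatRatio q p (t, v) ^ δ⁻¹) ^ ((δ - 1) / a)
          ≤ (1 + flatRatio q p (t, v) ^ δ⁻¹) ^ (-(1 / (2 * a)) : ℝ) := by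
            refine Real.rpow_le_rpow_of_exponent_le (by linarith) ?_
            rw [div_le_iff₀ ha']
            field_simp
            linarith [hδ.2]
        _ ≤ _ := Real.rpow_le_rpow_of_nonpos (by positivity) (by linarith)
            (by rw [neg_nonpos]; positivity)
    have := hvlim.mul ((hrlim.sub_const 1).mul hΦlim)
    simp only [scaledIntegrand]
    convert this using 2
    ring

theorem integrable_scaledLimit (hp : 0 < p) (hq : 2 ≤ q) (hab : 1 < (b / a : ℝ)) :
    IntegrableOn (scaledLimit a b q p) quadrant := by
  refine (integrable_scaledBound (a := a) (b := b) hp (by omega : 0 < q) hab 1).mono'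
    (Measurable.aestronglyMeasurable ?_)
    ((ae_restrict_iff' measurableSet_quadrant).2 (.of_forall fun z hz => ?_))
  · exact Measurable.indicator (by fun_prop)
      (measurableSet_lt measurable_const (measurable_flatRatio q p))
  · obtain ⟨t, v⟩ := z
    have ht : 0 < t := hz.1
    have hv : 0 < v := hz.2
    have h0 := scaleMajorant_nonneg ht
    by_cases h : 1 < flatRatio q p (t, v)
    · have h1 := min_one_flatRatio_le (p := p) hq ht hv
      rw [min_eq_left h.le] at h1
      rw [scaledLimit_of_one_lt h, Real.norm_of_nonneg (by positivity),
        scaledBound]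
      have h2 : 0 < v ^ (-((1 + b / a) / 2 : ℝ)) := by positivity
      have h3 : 0 < v ^ (-(b / a : ℝ)) := by positivity
      calc v ^ (-(b / a : ℝ)) ≤ (v ^ (-(b / a : ℝ)) + v ^ (-((1 + b / a) / 2 : ℝ))) *
            (Real.exp (-(1 / (2 * q)) / v ^ p) * scaleMajorant t) := by nlinarith
        _ = _ := by ring
    · rw [scaledLimit_of_le_one (not_lt.1 h), norm_zero, scaledBound]
      positivity

theorem setIntegral_scaledLimit_pos (hp : 0 < p) (hq : 2 ≤ q) (hab : 1 < (b / a : ℝ)) :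
    0 < ∫ z in quadrant, scaledLimit a b q p z := by
  have hnonneg : ∀ z ∈ quadrant, 0 ≤ scaledLimit a b q p z := by
    intro z hz
    have hz2 : 0 < z.2 := hz.2
    rcases lt_or_ge 1 (flatRatio q p z) with h | h
    · rw [scaledLimit_of_one_lt h]; positivity
    · rw [scaledLimit_of_le_one h]
  rw [setIntegral_pos_iff_support_of_nonneg_ae
    ((ae_restrict_iff' measurableSet_quadrant).2 (.of_forall hnonneg))
    (integrable_scaledLimit hp hq hab)]
  set c : ℝ := Real.exp (-1) with hc
  have hc0 : 0 < c := Real.exp_pos _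
  have hc1 : c < 1 := by simp [hc]
  -- On this box `t^q ≤ t < e^{-1} ≤ e^{-1/v^p}`, so it lies in the support.
  have hopen : IsOpen (Ioo 0 c ×ˢ Ioo (1 : ℝ) 2) := isOpen_Ioo.prod isOpen_Ioo
  refine (hopen.measure_pos volume ⟨(c / 2, 3 / 2), ⟨by positivity, by linarith⟩, by norm_num,
    by norm_num⟩).trans_le (measure_mono ?_)
  rintro ⟨t, v⟩ ⟨⟨ht0, ht1⟩, hv0, hv1⟩
  simp only at ht0 ht1 hv0 hv1
  have hv : 0 < v := by linarith
  refine ⟨?_, ht0, hv⟩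
  have hmem : 1 < flatRatio q p (t, v) := by
    rw [flatRatio, lt_div_iff₀ (by positivity), one_mul]
    calc t ^ q ≤ t ^ 1 := pow_le_pow_of_le_one ht0.le (by linarith) (by omega)
      _ < c := by simpa using ht1
      _ ≤ Real.exp (-1 / v ^ p) := by
        refine Real.exp_le_exp.2 ?_
        have : 1 ≤ v ^ p := Real.one_le_rpow hv0.le hp.le
        rw [neg_div, neg_le_neg_iff, div_le_one (by positivity)]
        exact this
  rw [Function.mem_support, scaledLimit_of_one_lt hmem]
  positivity

theorem tendsto_setIntegral_scaledIntegrand (ha : 0 < a) (hp : 0 < p) (hq : 2 ≤ q)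
    (hab : 1 < (b / a : ℝ)) (hΦ : Continuous Φ) (hc : HasCompactSupport Φ) :
    Tendsto (fun δ => ∫ z in quadrant, scaledIntegrand a b q p Φ δ z) (𝓝[>] 0)
      (𝓝 (-Φ (0, 0) * ∫ z in quadrant, scaledLimit a b q p z)) := by
  obtain ⟨M, R, -, -, hΦM, -⟩ := exists_bound_of_hasCompactSupport hΦ hc
  rw [← integral_const_mul]
  refine tendsto_integral_filter_of_dominated_convergence (scaledBound a b q p M)
    (.of_forall fun δ => (measurable_scaledIntegrand hΦ δ).aestronglyMeasurable) ?_
    (integrable_scaledBound hp (by omega) hab M) ?_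
  · have hδ₀ : 0 < ((b / a : ℝ) - 1) / (2 * (b / a)) := div_pos (by linarith) (by linarith)
    filter_upwards [Ioo_mem_nhdsGT hδ₀] with δ hδ
    refine (ae_restrict_iff' measurableSet_quadrant).2 (.of_forall fun z hz => ?_)
    exact abs_scaledIntegrand_le ha hq hab hΦM hδ.1 hδ.2.le hz
  · filter_upwards [ae_restrict_mem measurableSet_quadrant, ae_flatRatio_ne_one (q := q) hp]
      with z hz hz1
    exact tendsto_scaledIntegrand ha hp hΦ hΦM hz hz1

end Scaling

/-! ### The substitution and the growth of the flat part -/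

section Rescale

variable {a b q : ℕ} {p : ℝ} {Φ : ℝ × ℝ → ℝ}

/-- The integrand of `flatZ` at the real point `s = (δ - 1) / a`. -/
noncomputable def flatRealIntegrand (a b q : ℕ) (p : ℝ) (Φ : ℝ × ℝ → ℝ) (δ : ℝ) (z : ℝ × ℝ) : ℝ :=
  z.1 ^ (δ - 1) * (z.2 ^ (b / a * (δ - 1)) *
    (((1 + flatRatio q p z) ^ ((δ - 1) / a) - 1) * Φ z))

theorem flatIntegrand_ofReal (ha : 0 < a) (δ : ℝ) {z : ℝ × ℝ} (hz : z ∈ quadrant) :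
    monoKer a b (((δ - 1) / a : ℝ) : ℂ) z * flatKer q p (((δ - 1) / a : ℝ) : ℂ) z * (Φ z : ℂ) =
      (flatRealIntegrand a b q p Φ δ z : ℂ) := by
  obtain ⟨x, y⟩ := z
  have hx : 0 < x := hz.1
  have hy : 0 < y := hz.2
  have hh := flatRatio_pos q p hx y
  have ha' : (a : ℝ) ≠ 0 := by exact_mod_cast ha.ne'
  rw [monoKer, flatKer, flatRealIntegrand, ← Complex.ofReal_mul, ← Complex.ofReal_mul,
    ← Complex.ofReal_exp, ← Complex.ofReal_exp, ← Complex.ofReal_one, ← Complex.ofReal_sub,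
    ← Complex.ofReal_mul, ← Complex.ofReal_mul]
  congr 1
  have h1 : Real.exp ((δ - 1) / a * (a * Real.log x + b * Real.log y)) =
      x ^ (δ - 1) * y ^ (b / a * (δ - 1) : ℝ) := by
    rw [Real.rpow_def_of_pos hx, Real.rpow_def_of_pos hy, ← Real.exp_add]
    congr 1
    field_simp
  have h2 : Real.exp ((δ - 1) / a * Real.log (1 + flatRatio q p (x, y))) =
      (1 + flatRatio q p (x, y)) ^ ((δ - 1) / a) := by
    rw [Real.rpow_def_of_pos (by linarith), mul_comm]
  simp only at h1 h2 ⊢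
  rw [h1, h2]
  ring

/-- The scale `δ^{1/p}` is chosen so that `1/y^p = 1/(δ v^p)`: numerator and denominator both become
`1/δ`-th powers. -/
theorem flatRatio_rescale (hp : 0 < p) {δ t v : ℝ} (hδ : 0 < δ) (ht : 0 < t) (hv : 0 < v) :
    flatRatio q p (t ^ δ⁻¹, δ ^ p⁻¹ * v) = flatRatio q p (t, v) ^ δ⁻¹ := by
  rw [flatRatio_rpow ht, flatRatio]
  simp only
  rw [Real.mul_rpow (by positivity) hv.le, ← Real.rpow_mul hδ.le, inv_mul_cancel₀ hp.ne',
    Real.rpow_one, ← Real.rpow_natCast, ← Real.rpow_mul ht.le, div_eq_mul_inv, ← Real.rpow_neg ht.le]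
  congr 2
  · field_simp
  · ring

theorem integrable_scaledIntegrand (ha : 0 < a) (hp : 0 < p) (hq : 2 ≤ q)
    (hab : 1 < (b / a : ℝ)) (hΦ : Continuous Φ) (hc : HasCompactSupport Φ) {δ : ℝ} (hδ : 0 < δ)
    (hδ1 : δ ≤ ((b / a : ℝ) - 1) / (2 * (b / a))) :
    IntegrableOn (scaledIntegrand a b q p Φ δ) quadrant := by
  obtain ⟨M, R, -, -, hΦM, -⟩ := exists_bound_of_hasCompactSupport hΦ hc
  refine (integrable_scaledBound (q := q) hp (by omega) hab M).mono'
    (measurable_scaledIntegrand hΦ δ).aestronglyMeasurable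
    ((ae_restrict_iff' measurableSet_quadrant).2 (.of_forall fun z hz => ?_))
  exact abs_scaledIntegrand_le ha hq hab hΦM hδ hδ1 hz

/-- Powers of `δ`: `x^{δ-1} dx = δ^{-1} dt`, and `y^{(b/a)(δ-1)} dy` yields `δ^{((b/a)(δ-1) +
1)/p}`. Their product is `δ^{-(1+κ)}`, `κ = (b/a - 1)/p`, times `δ^{(b/a)δ/p}`, and the last factor
tends to `1`. -/
theorem rpow_mul_flatZ_eq (ha : 0 < a) (hp : 0 < p) (hq : 2 ≤ q) (hqa : q ≤ a)
    (hab : 1 < (b / a : ℝ)) (hΦ : Continuous Φ) (hc : HasCompactSupport Φ) {δ : ℝ} (hδ : 0 < δ)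
    (hδ1 : δ ≤ ((b / a : ℝ) - 1) / (2 * (b / a))) :
    ((δ ^ (1 + ((b / a : ℝ) - 1) / p) : ℝ) : ℂ) * flatZ a b q p Φ (((δ - 1) / a : ℝ) : ℂ) =
      ((δ ^ (b / a * δ / p) * ∫ z in quadrant, scaledIntegrand a b q p Φ δ z : ℝ) : ℂ) := by
  have ha' : (0 : ℝ) < a := by exact_mod_cast ha
  have hs : ((((δ - 1) / a : ℝ)) : ℂ) ∈ halfPlane (-(1 / (a : ℝ))) := by
    change -(1 / (a : ℝ)) < ((((δ - 1) / a : ℝ)) : ℂ).re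
    rw [Complex.ofReal_re, ← neg_div]
    gcongr
    linarith
  have hint := integrableOn_flatIntegrand (b := b) ha hp (by omega : 0 < q) hqa hΦ hc hs
  have hreal : IntegrableOn (flatRealIntegrand a b q p Φ δ) quadrant := by
    have h1 := hint.congr_fun (fun z hz => flatIntegrand_ofReal ha δ hz) measurableSet_quadrant
    simpa [IntegrableOn] using Integrable.re h1
  have h1 : flatZ a b q p Φ (((δ - 1) / a : ℝ) : ℂ) =
      ((∫ z in quadrant, flatRealIntegrand a b q p Φ δ z : ℝ) : ℂ) := by
    rw [flatZ, ← integral_complex_ofReal]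
    exact setIntegral_congr_fun measurableSet_quadrant fun z hz => flatIntegrand_ofReal ha δ hz
  rw [h1, ← Complex.ofReal_mul]
  congr 1
  have hscaled := integrable_scaledIntegrand ha hp hq hab hΦ hc hδ hδ1
  rw [restrict_quadrant, integral_prod_symm _ (by rwa [IntegrableOn, restrict_quadrant] at hreal),
    integral_prod_symm _ (by rwa [IntegrableOn, restrict_quadrant] at hscaled)]
  set k : ℝ → ℝ → ℝ := fun x y => y ^ (b / a * (δ - 1) : ℝ) *
    (((1 + flatRatio q p (x, y)) ^ ((δ - 1) / a) - 1) * Φ (x, y)) with hk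
  have hinner : ∀ y, ∫ x in Ioi 0, flatRealIntegrand a b q p Φ δ (x, y) =
      δ⁻¹ * ∫ t in Ioi 0, k (t ^ δ⁻¹) y := by
    intro y
    rw [← integral_comp_rpow_Ioi_of_pos (g := fun t => k (t ^ δ⁻¹) y) hδ, ← integral_const_mul]
    refine setIntegral_congr_fun measurableSet_Ioi fun x hx => ?_
    have hx : 0 < x := hx
    simp only [smul_eq_mul]
    rw [← Real.rpow_mul hx.le, mul_inv_cancel₀ hδ.ne', Real.rpow_one, mul_assoc,
      inv_mul_cancel_left₀ hδ.ne']
    rfl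
  have hscale : ∀ v ∈ Ioi (0 : ℝ), ∫ t in Ioi 0, k (t ^ δ⁻¹) (δ ^ p⁻¹ * v) =
      δ ^ (p⁻¹ * (b / a * (δ - 1))) * ∫ t in Ioi 0, scaledIntegrand a b q p Φ δ (t, v) := by
    intro v hv
    have hv : 0 < v := hv
    rw [← integral_const_mul]
    refine setIntegral_congr_fun measurableSet_Ioi fun t ht => ?_
    simp only [hk, scaledIntegrand]
    rw [flatRatio_rescale hp hδ ht hv, Real.mul_rpow (by positivity) hv.le, ← Real.rpow_mul hδ.le,
      mul_assoc]
  have houter := integral_comp_mul_left_Ioi (fun y => ∫ t in Ioi 0, k (t ^ δ⁻¹) y) 0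
    (by positivity : 0 < δ ^ p⁻¹)
  rw [mul_zero, setIntegral_congr_fun measurableSet_Ioi hscale, integral_const_mul, smul_eq_mul,
    eq_inv_mul_iff_mul_eq₀ (by positivity)] at houter
  simp only [hinner]
  rw [integral_const_mul, ← houter, ← mul_assoc, ← mul_assoc, ← mul_assoc]
  congr 1
  rw [← Real.rpow_neg_one, ← Real.rpow_add hδ, ← Real.rpow_add hδ, ← Real.rpow_add hδ]
  congr 1
  field_simp
  ring

theorem tendsto_rpow_mul_self (c : ℝ) : Tendsto (fun δ : ℝ => δ ^ (c * δ)) (𝓝[>] 0) (𝓝 1) := by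
  have h1 := (tendsto_log_mul_rpow_nhdsGT_zero one_pos).const_mul c
  rw [mul_zero] at h1
  have h2 := (Real.continuous_exp.tendsto 0).comp h1
  rw [Real.exp_zero] at h2
  refine h2.congr' ?_
  filter_upwards [self_mem_nhdsWithin] with δ hδ
  rw [Function.comp_apply, Real.rpow_one, Real.rpow_def_of_pos hδ]
  ring_nf

/-- The singular behaviour of the flat part at `s = -1/a`. -/
theorem tendsto_rpow_mul_flatZ (ha : 0 < a) (hp : 0 < p) (hq : 2 ≤ q) (hqa : q ≤ a)
    (hab : 1 < (b / a : ℝ)) (hΦ : Continuous Φ) (hc : HasCompactSupport Φ) (h0 : Φ (0, 0) ≠ 0) :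
    ∃ c : ℂ, c ≠ 0 ∧ Tendsto (fun δ : ℝ => ((δ ^ (1 + ((b / a : ℝ) - 1) / p) : ℝ) : ℂ) *
      flatZ a b q p Φ (((δ - 1) / a : ℝ) : ℂ)) (𝓝[>] 0) (𝓝 c) := by
  refine ⟨((1 * (-Φ (0, 0) * ∫ z in quadrant, scaledLimit a b q p z) : ℝ) : ℂ), ?_, ?_⟩
  · rw [Complex.ofReal_ne_zero, one_mul]
    exact mul_ne_zero (neg_ne_zero.2 h0) (setIntegral_scaledLimit_pos hp hq hab).ne'
  · have h1 := (tendsto_rpow_mul_self (b / a / p)).mul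
      (tendsto_setIntegral_scaledIntegrand ha hp hq hab hΦ hc)
    refine ((Complex.continuous_ofReal.tendsto _).comp h1).congr' ?_
    have hδ₀ : 0 < ((b / a : ℝ) - 1) / (2 * (b / a)) := div_pos (by linarith) (by linarith)
    filter_upwards [Ioo_mem_nhdsGT hδ₀] with δ hδ
    rw [rpow_mul_flatZ_eq ha hp hq hqa hab hΦ hc hδ.1 hδ.2.le, Function.comp_apply]
    congr 3
    ring

end Rescale

/-! ### The continuation and its growth at `-1/a` -/

theorem isOpen_halfPlane (c : ℝ) : IsOpen (halfPlane c) :=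
  isOpen_lt continuous_const Complex.continuous_re

theorem isPreconnected_halfPlane (c : ℝ) : IsPreconnected (halfPlane c) :=
  (convex_halfSpace_re_gt c).isPreconnected

section Continuation

variable {a b q N : ℕ} {p : ℝ} {Φ : ℝ × ℝ → ℝ}

/-- The meromorphic continuation of the zeta integral: the monomial part after `N` integrations by
parts, plus the flat part. -/
noncomputable def contZ (a b q N : ℕ) (p : ℝ) (Φ : ℝ × ℝ → ℝ) (s : ℂ) : ℂ :=
  (-1) ^ N * monoZ a b N (partialSnd^[N] Φ) s / ∏ j ∈ Finset.range N, (b * s + j + 1) +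
    flatZ a b q p Φ s

theorem analyticAt_prod_linear (b N : ℕ) (s : ℂ) :
    AnalyticAt ℂ (fun s : ℂ => ∏ j ∈ Finset.range N, (b * s + j + 1)) s := by
  refine Differentiable.analyticAt ?_ s
  fun_prop

theorem analyticAt_monoZ (ha : 0 < a) (hb : 0 < b) (hN : b ≤ a * (N + 1))
    (hΦ : ContDiff ℝ (⊤ : ℕ∞) Φ) (hc : HasCompactSupport Φ) {s : ℂ}
    (hs : s ∈ halfPlane (-(1 / (a : ℝ)))) : AnalyticAt ℂ (monoZ a b N (partialSnd^[N] Φ)) s :=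
  (differentiableOn_monoZ ha hb hN (contDiff_iterate_partialSnd hΦ N).continuous
    (hasCompactSupport_iterate_partialSnd hc N)).analyticAt ((isOpen_halfPlane _).mem_nhds hs)

theorem analyticAt_flatZ (ha : 0 < a) (hp : 0 < p) (hq : 0 < q) (hqa : q ≤ a)
    (hΦ : Continuous Φ) (hc : HasCompactSupport Φ) {s : ℂ}
    (hs : s ∈ halfPlane (-(1 / (a : ℝ)))) : AnalyticAt ℂ (flatZ a b q p Φ) s :=
  (differentiableOn_flatZ ha hp hq hqa hΦ hc).analyticAt ((isOpen_halfPlane _).mem_nhds hs)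

theorem meromorphicOn_contZ (ha : 0 < a) (hb : 0 < b) (hN : b ≤ a * (N + 1)) (hp : 0 < p)
    (hq : 0 < q) (hqa : q ≤ a) (hΦ : ContDiff ℝ (⊤ : ℕ∞) Φ) (hc : HasCompactSupport Φ) :
    MeromorphicOn (contZ a b q N p Φ) (halfPlane (-(1 / (a : ℝ)))) := by
  intro s hs
  exact ((analyticAt_const.mul (analyticAt_monoZ ha hb hN hΦ hc hs)).meromorphicAt.div
    (analyticAt_prod_linear b N s).meromorphicAt).add
    (analyticAt_flatZ ha hp hq hqa hΦ.continuous hc hs).meromorphicAt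

theorem analyticAt_contZ (ha : 0 < a) (hb : 0 < b) (hN : b ≤ a * (N + 1)) (hp : 0 < p)
    (hq : 0 < q) (hqa : q ≤ a) (hΦ : ContDiff ℝ (⊤ : ℕ∞) Φ) (hc : HasCompactSupport Φ) {s : ℂ}
    (hs : s ∈ halfPlane (-(1 / (a : ℝ)))) (h0 : ∏ j ∈ Finset.range N, (b * s + j + 1) ≠ 0) :
    AnalyticAt ℂ (contZ a b q N p Φ) s :=
  ((analyticAt_const.mul (analyticAt_monoZ ha hb hN hΦ hc hs)).div
    (analyticAt_prod_linear b N s) h0).add (analyticAt_flatZ ha hp hq hqa hΦ.continuous hc hs)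

theorem eqOn_contZ (ha : 0 < a) (hp : 0 < p) (hq : 0 < q) (hqe : Even q) (hqa : q ≤ a)
    {φ : ℝ × ℝ → ℝ} (hφ : ContDiff ℝ (⊤ : ℕ∞) φ) (hc : HasCompactSupport φ) :
    EqOn (contZ a b q N p (signSum φ)) (Z (modelFun a b q p) φ) (halfPlane 0) := by
  intro s hs
  have hs : 0 < s.re := hs
  have hprod : ∏ j ∈ Finset.range N, ((b : ℂ) * s + j + 1) ≠ 0 := by
    refine Finset.prod_ne_zero_iff.2 fun j _ h => ?_
    have h1 := congrArg Complex.re h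
    simp at h1
    have : 0 ≤ (b : ℝ) * s.re := by positivity
    have : (0 : ℝ) ≤ j := by positivity
    linarith
  rw [Z_modelFun_eq ha hp hq hqe hqa hφ hc hs, contZ, ← monoZ_zero_mul_prod (contDiff_signSum hφ)
    (hasCompactSupport_signSum hc) hs N, mul_div_cancel_right₀ _ hprod]

/-- At `s = (δ-1)/a` the factors in `norm_monoZ_le` are `δ` and `N + 1 + k - b/a + (b/a)δ`. The
second degenerates only if `k = 0` and `b/a = N + 1`. -/
theorem exists_norm_monoZ_le (ha : 0 < a) (hab : 1 < (b / a : ℝ)) (hp : 0 < p)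
    (hcase : p < (b : ℝ) / (a : ℝ) - 1 ∨ ¬ ∃ n : ℤ, Odd n ∧ (b : ℝ) / (a : ℝ) = (n : ℝ))
    (hN : b ≤ a * (N + 1)) (hΦ : ContDiff ℝ (⊤ : ℕ∞) Φ)
    (hc : HasCompactSupport Φ) (heven : ∀ x y, Φ (x, -y) = Φ (x, y)) :
    ∃ r C : ℝ, r < 1 + ((b / a : ℝ) - 1) / p ∧ ∀ δ : ℝ, 0 < δ → δ < 1 →
      ‖monoZ a b N (partialSnd^[N] Φ) (((δ - 1) / a : ℝ) : ℂ)‖ ≤ C * δ ^ (-r) := by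
  have ha' : (0 : ℝ) < a := by exact_mod_cast ha
  have hba : (b : ℝ) / a ≤ N + 1 := by
    rw [div_le_iff₀ ha']
    have : (b : ℝ) ≤ a * (N + 1) := by exact_mod_cast hN
    linarith
  set Ψ := partialSnd^[N] Φ with hΨ
  have hΨs : ContDiff ℝ (⊤ : ℕ∞) Ψ := contDiff_iterate_partialSnd hΦ N
  have hΨc : HasCompactSupport Ψ := hasCompactSupport_iterate_partialSnd hc N
  obtain ⟨M, R, hM, hR, hΨM, hΨR⟩ := exists_bound_of_hasCompactSupport hΨs.continuous hΨc
  have hgen : ∀ (k : ℕ) (M' : ℝ), 0 ≤ M' → (∀ x y, 0 < y → |Ψ (x, y)| ≤ M' * y ^ k) → ∀ δ : ℝ,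
      0 < δ → δ < 1 → ∀ η, 0 < η → η ≤ N + 1 + k - b / a + b / a * δ →
      ‖monoZ a b N Ψ (((δ - 1) / a : ℝ) : ℂ)‖ ≤ M' * R ^ (N + k + 2) / (δ * η) := by
    intro k M' hM' hbd δ hδ hδ1 η hη hη1
    have e1 : (a : ℝ) * ((δ - 1) / a) + 1 = δ := by field_simp; ring
    have e2 : (b : ℝ) * ((δ - 1) / a) + N + k + 1 = N + 1 + k - b / a + b / a * δ := by
      field_simp; ring
    have h1 := norm_monoZ_le (b := b) (N := N) (s := (((δ - 1) / a : ℝ) : ℂ)) ha hM' hR hbd hΨR ?_ ?_ ?_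
    · rw [Complex.ofReal_re, e1, e2] at h1
      refine h1.trans ?_
      gcongr
    · rw [Complex.ofReal_re, ← neg_div]
      gcongr
      linarith
    · rw [Complex.ofReal_re]
      exact div_nonpos_of_nonpos_of_nonneg (by linarith) ha'.le
    · rw [Complex.ofReal_re, e2]; linarith
  have hκ : 0 < ((b / a : ℝ) - 1) / p := div_pos (by linarith) hp
  rcases hcase with hcase | hcase
  -- Here `(b/a - 1)/p > 1`, so even a double pole is of smaller order than the flat part.
  · refine ⟨2, M * R ^ (N + 0 + 2), ?_, fun δ hδ hδ1 => ?_⟩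
    · have : 1 < ((b / a : ℝ) - 1) / p := (one_lt_div hp).2 hcase
      linarith
    · refine (hgen 0 M hM (fun x y _ => by simpa using hΨM (x, y)) δ hδ hδ1 δ hδ ?_).trans
        (le_of_eq ?_)
      · push_cast; nlinarith
      · rw [Real.rpow_neg hδ.le, show (2 : ℝ) = ((2 : ℕ) : ℝ) by norm_num, Real.rpow_natCast,
          div_eq_mul_inv, sq]
  · have hone : ∀ C η δ : ℝ, 0 < δ → C / (δ * η) = C / η * δ ^ (-1 : ℝ) := by
      intro C η δ hδ
      rw [Real.rpow_neg_one, mul_comm δ, ← div_div, div_eq_mul_inv (C / η)]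
    rcases hba.lt_or_eq with hlt | heq
    · refine ⟨1, M * R ^ (N + 0 + 2) / (N + 1 - b / a), by linarith, fun δ hδ hδ1 => ?_⟩
      rw [← hone _ _ _ hδ]
      refine hgen 0 M hM (fun x y _ => by simpa using hΨM (x, y)) δ hδ hδ1 _ (by linarith) ?_
      have : 0 < b / a * δ := by positivity
      push_cast; linarith
    -- Borderline `b/a = N + 1`, an even integer: an odd number of `y`-derivatives of the even `Φ`
    -- is odd, so it vanishes on the axis and gains a factor `y`, which removes one order of growth.
    · have hNodd : Odd N := by
        by_contra hcon
        refine hcase ⟨(N : ℤ) + 1, ?_, by rw [heq]; push_cast; ring⟩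
        rw [Nat.not_odd_iff_even] at hcon
        exact (by exact_mod_cast hcon : Even (N : ℤ)).add_one
      obtain ⟨M', hM', hbd⟩ := exists_abs_le_mul_of_odd hΨs hΨc fun x y => by
        rw [hΨ, iterate_partialSnd_neg hΦ heven, hNodd.neg_one_pow, neg_one_mul]
      refine ⟨1, M' * R ^ (N + 1 + 2) / 1, by linarith, fun δ hδ hδ1 => ?_⟩
      rw [← hone _ _ _ hδ]
      refine hgen 1 M' hM' (fun x y hy => by simpa using hbd x y hy) δ hδ hδ1 _ one_pos ?_
      have : 0 < b / a * δ := by positivity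
      push_cast; linarith

theorem tendsto_ofReal_sub_one_div (a : ℕ) :
    Tendsto (fun δ : ℝ => (((δ - 1) / a : ℝ) : ℂ)) (𝓝[>] 0) (𝓝 (-(1 / (a : ℂ)))) := by
  have h : Continuous fun δ : ℝ => (((δ - 1) / a : ℝ) : ℂ) := by fun_prop
  have h1 := h.tendsto 0
  rw [show (((0 - 1) / a : ℝ) : ℂ) = -(1 / (a : ℂ)) by push_cast; ring] at h1
  exact h1.mono_left nhdsWithin_le_nhds

/-- The poles `-(j+1)/b`, `j < N`, all lie strictly to the right of `-1/a` because `aN < b`. -/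
theorem prod_linear_ne_zero (ha : 0 < a) (hN : a * N < b) :
    ∏ j ∈ Finset.range N, ((b : ℂ) * (-(1 / (a : ℂ))) + j + 1) ≠ 0 := by
  refine Finset.prod_ne_zero_iff.2 fun j hj h => ?_
  have ha' : (a : ℂ) ≠ 0 := by exact_mod_cast ha.ne'
  have h1 : (a : ℂ) * (j + 1) = b := by
    field_simp at h
    linear_combination h
  have h2 : a * (j + 1) = b := by exact_mod_cast h1
  have h3 : a * (j + 1) ≤ a * N := Nat.mul_le_mul_left a (Finset.mem_range.1 hj)
  omega

/-- The singular behaviour of the continuation at `s = -1/a`. -/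
theorem tendsto_rpow_mul_contZ (ha : 0 < a) (hp : 0 < p) (hq : 2 ≤ q) (hqa : q ≤ a)
    (hab : 1 < (b / a : ℝ))
    (hcase : p < (b : ℝ) / (a : ℝ) - 1 ∨ ¬ ∃ n : ℤ, Odd n ∧ (b : ℝ) / (a : ℝ) = (n : ℝ))
    (hN : b ≤ a * (N + 1)) (hN' : a * N < b) (hΦ : ContDiff ℝ (⊤ : ℕ∞) Φ)
    (hc : HasCompactSupport Φ) (heven : ∀ x y, Φ (x, -y) = Φ (x, y)) (h0 : Φ (0, 0) ≠ 0) :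
    ∃ c : ℂ, c ≠ 0 ∧ Tendsto (fun δ : ℝ => ((δ ^ (1 + ((b / a : ℝ) - 1) / p) : ℝ) : ℂ) *
      contZ a b q N p Φ (((δ - 1) / a : ℝ) : ℂ)) (𝓝[>] 0) (𝓝 c) := by
  obtain ⟨c, hc0, hlim⟩ := tendsto_rpow_mul_flatZ ha hp hq hqa hab hΦ.continuous hc h0
  refine ⟨c, hc0, ?_⟩
  obtain ⟨r, C, hr, hbound⟩ := exists_norm_monoZ_le ha hab hp hcase hN hΦ hc heven
  have h1 : Tendsto (fun δ : ℝ => ((δ ^ (1 + ((b / a : ℝ) - 1) / p) : ℝ) : ℂ) *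
      monoZ a b N (partialSnd^[N] Φ) (((δ - 1) / a : ℝ) : ℂ)) (𝓝[>] 0) (𝓝 0) := by
    have h2 : Tendsto (fun δ : ℝ => C * δ ^ (1 + ((b / a : ℝ) - 1) / p - r)) (𝓝[>] 0) (𝓝 0) := by
      have h3 := ((Real.continuousAt_rpow_const 0 (1 + ((b / a : ℝ) - 1) / p - r)
        (Or.inr (by linarith))).tendsto.const_mul C).mono_left
        (nhdsWithin_le_nhds (s := Ioi (0 : ℝ)))
      rwa [Real.zero_rpow (by linarith), mul_zero] at h3
    refine squeeze_zero_norm' ?_ h2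
    filter_upwards [Ioo_mem_nhdsGT (zero_lt_one' ℝ)] with δ hδ
    have hδ0 : 0 < δ := hδ.1
    have hadd := Real.rpow_add hδ0 (1 + ((b / a : ℝ) - 1) / p) (-r)
    rw [← sub_eq_add_neg] at hadd
    rw [norm_mul, Complex.norm_real, Real.norm_of_nonneg (by positivity), hadd]
    calc _ ≤ δ ^ (1 + ((b / a : ℝ) - 1) / p) * (C * δ ^ (-r)) := by
          gcongr
          exact hbound δ hδ.1 hδ.2
      _ = _ := by ring
  have h2 := ((analyticAt_prod_linear b N _).continuousAt.tendsto.comp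
    (tendsto_ofReal_sub_one_div a)).inv₀ (prod_linear_ne_zero ha hN')
  have h3 := ((h1.mul h2).const_mul ((-1 : ℂ) ^ N)).add hlim
  rw [zero_mul, mul_zero, zero_add] at h3
  refine h3.congr fun δ => ?_
  rw [contZ, Function.comp_apply]
  ring

end Continuation

/-! ### Integrality of growth and uniqueness of continuation -/

/-- A meromorphic function has an integral growth exponent. -/
theorem exists_int_of_tendsto_rpow_mul {F : ℂ → ℂ} {s₀ c : ℂ} {κ d : ℝ} (hF : MeromorphicAt F s₀)
    (hd : 0 < d) (hc : c ≠ 0)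
    (hlim : Tendsto (fun δ : ℝ => ((δ ^ κ : ℝ) : ℂ) * F (s₀ + (δ / d : ℝ))) (𝓝[>] 0) (𝓝 c)) :
    ∃ n : ℤ, κ = n := by
  have hpt : Tendsto (fun δ : ℝ => s₀ + ((δ / d : ℝ) : ℂ)) (𝓝[>] 0) (𝓝[≠] s₀) := by
    rw [tendsto_nhdsWithin_iff]
    constructor
    · have h : Continuous fun δ : ℝ => s₀ + ((δ / d : ℝ) : ℂ) := by fun_prop
      have h1 := h.tendsto 0
      simp only [zero_div, Complex.ofReal_zero, add_zero] at h1
      exact h1.mono_left nhdsWithin_le_nhds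
    · filter_upwards [self_mem_nhdsWithin] with δ hδ
      have hδ : 0 < δ := hδ
      simp only [mem_compl_iff, mem_singleton_iff, add_eq_left, Complex.ofReal_eq_zero]
      positivity
  by_cases htop : meromorphicOrderAt F s₀ = ⊤
  · rw [meromorphicOrderAt_eq_top_iff] at htop
    refine absurd (tendsto_nhds_unique (hlim.congr' ?_) tendsto_const_nhds) hc
    filter_upwards [hpt.eventually htop] with δ hδ
    rw [hδ, mul_zero]
  obtain ⟨g, hg, hg0, hFg⟩ := (meromorphicOrderAt_ne_top_iff hF).1 htop
  set n := (meromorphicOrderAt F s₀).untop₀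
  refine ⟨-n, ?_⟩
  have hglim : Tendsto (fun δ : ℝ => g (s₀ + ((δ / d : ℝ) : ℂ))) (𝓝[>] 0) (𝓝 (g s₀)) :=
    hg.continuousAt.tendsto.comp (hpt.mono_right nhdsWithin_le_nhds)
  have hgne : ∀ᶠ δ : ℝ in 𝓝[>] 0, g (s₀ + ((δ / d : ℝ) : ℂ)) ≠ 0 := hglim.eventually_ne hg0
  -- Dividing by `F = (z - s₀)^n g` shows that `δ^{κ+n}` has a finite positive limit, which forces
  -- `κ + n = 0`.
  have hmain : Tendsto (fun δ : ℝ => δ ^ (κ + n)) (𝓝[>] 0) (𝓝 (‖c‖ / ‖g s₀‖ * d ^ n)) := by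
    refine ((hlim.norm.div hglim.norm (norm_ne_zero_iff.2 hg0)).mul_const (d ^ n)).congr' ?_
    filter_upwards [hpt.eventually hFg, hgne, self_mem_nhdsWithin] with δ hδ hgδ hδ0
    have hδ0 : 0 < δ := hδ0
    rw [Pi.div_apply, hδ, add_sub_cancel_left, norm_mul, norm_smul, norm_zpow, Complex.norm_real,
      Complex.norm_real, Real.norm_of_nonneg (by positivity), Real.norm_of_nonneg (by positivity),
      Real.rpow_add hδ0, Real.rpow_intCast, div_zpow]
    have := norm_ne_zero_iff.2 hgδ
    field_simp
  have hpos : 0 < ‖c‖ / ‖g s₀‖ * d ^ n := by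
    have := norm_pos_iff.2 hg0
    have := norm_pos_iff.2 hc
    positivity
  rcases lt_trichotomy (κ + n) 0 with h | h | h
  · exact absurd hmain (not_tendsto_nhds_of_tendsto_atTop (tendsto_rpow_neg_nhdsGT_zero h) _)
  · push_cast; linarith
  · have h1 := (Real.continuousAt_rpow_const 0 (κ + n) (Or.inr h.le)).tendsto.mono_left
      (nhdsWithin_le_nhds (s := Ioi (0 : ℝ)))
    rw [Real.zero_rpow h.ne'] at h1
    exact absurd (tendsto_nhds_unique hmain h1) hpos.ne'

/-- Two meromorphic functions on a half-plane that agree on a smaller one agree near every point. -/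
theorem eventuallyEq_of_eqOn_halfPlane {F G : ℂ → ℂ} {c d : ℝ} (hcd : c ≤ d)
    (hF : MeromorphicOn F (halfPlane c)) (hG : MeromorphicOn G (halfPlane c))
    (hFG : EqOn F G (halfPlane d)) {s : ℂ} (hs : s ∈ halfPlane c) : F =ᶠ[𝓝[≠] s] G := by
  have hsub : MeromorphicOn (F - G) (halfPlane c) := hF.sub hG
  have hmem : ((d + 1 : ℝ) : ℂ) ∈ halfPlane d := by simp [halfPlane]
  have h1 : meromorphicOrderAt (F - G) ((d + 1 : ℝ) : ℂ) = ⊤ := by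
    rw [meromorphicOrderAt_eq_top_iff]
    filter_upwards [nhdsWithin_le_nhds ((isOpen_halfPlane d).mem_nhds hmem)] with z hz
    rw [Pi.sub_apply, hFG hz, sub_self]
  have h2 : meromorphicOrderAt (F - G) s = ⊤ := by
    by_contra hne
    exact hsub.meromorphicOrderAt_ne_top_of_isPreconnected (isPreconnected_halfPlane c) hs
      (lt_of_le_of_lt hcd hmem : c < _) hne h1
  rw [meromorphicOrderAt_eq_top_iff] at h2
  filter_upwards [h2] with z hz
  exact sub_eq_zero.1 hz

/-! ### Continuation up to `-1/a` and its failure beyond -/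

section Main

variable {a b q : ℕ} {p : ℝ}

theorem hasMeromorphicContinuation_modelFun (ha : 0 < a) (hb : 0 < b) (hp : 0 < p)
    (hq : 0 < q) (hqe : Even q) (hqa : q ≤ a) {φ : ℝ × ℝ → ℝ} (hφ : ContDiff ℝ (⊤ : ℕ∞) φ)
    (hc : HasCompactSupport φ) :
    HasMeromorphicContinuation (modelFun a b q p) φ (halfPlane (-(1 / (a : ℝ)))) :=
  -- For continuation alone any `N` with `b ≤ a(N+1)` will do; `N = b` is the simplest.
  ⟨contZ a b q b p (signSum φ), meromorphicOn_contZ ha hb (by nlinarith) hp hq hqa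
    (contDiff_signSum hφ) (hasCompactSupport_signSum hc), eqOn_contZ ha hp hq hqe hqa hφ hc⟩

/-- A general `D` covers both `D = {Re s > -1/a} ∪ V` and the half-planes `Re s > -ρ` with `ρ > 1/a`
that enter `m0`. -/
theorem not_hasMeromorphicContinuation_modelFun (ha : 0 < a) (hb : 0 < b) (hp : 0 < p) (hq : 2 ≤ q)
    (hqe : Even q) (hqa : q ≤ a) (hab : 1 < (b / a : ℝ))
    (hcase : p < (b : ℝ) / (a : ℝ) - 1 ∨ ¬ ∃ n : ℤ, Odd n ∧ (b : ℝ) / (a : ℝ) = (n : ℝ))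
    (hint : ¬ ∃ n : ℤ, ((b : ℝ) / (a : ℝ) - 1) / p = (n : ℝ)) {φ : ℝ × ℝ → ℝ}
    (hφ : ContDiff ℝ (⊤ : ℕ∞) φ) (hc : HasCompactSupport φ) (h0 : φ (0, 0) ≠ 0) {D : Set ℂ}
    (hD : halfPlane (-(1 / (a : ℝ))) ⊆ D) (hmem : -(1 / (a : ℂ)) ∈ D) :
    ¬ HasMeromorphicContinuation (modelFun a b q p) φ D := by
  rintro ⟨F, hF, hFZ⟩
  have ha' : (0 : ℝ) < a := by exact_mod_cast ha
  -- `N = ⌈b/a⌉ - 1`: enough integrations by parts for convergence, few enough that the product does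
  -- not vanish at `-1/a`.
  obtain ⟨N, hN, hN'⟩ : ∃ N, b ≤ a * (N + 1) ∧ a * N < b := by
    refine ⟨(b - 1) / a, ?_, ?_⟩
    · have := Nat.lt_mul_div_succ (b - 1) ha
      omega
    · have := Nat.mul_div_le (b - 1) a
      omega
  have hΦ := contDiff_signSum hφ
  have hΦc := hasCompactSupport_signSum hc
  have hq0 : 0 < q := by omega
  obtain ⟨c, hc0, hlim⟩ := tendsto_rpow_mul_contZ ha hp hq hqa hab hcase hN hN' hΦ hΦc
    (signSum_neg_snd φ) (by rw [signSum_zero]; exact mul_ne_zero four_ne_zero h0)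
  have hFm := hF _ hmem
  have hpoint : ∀ δ : ℝ, (((δ - 1) / a : ℝ) : ℂ) = -(1 / (a : ℂ)) + ((δ / a : ℝ) : ℂ) := by
    intro δ; push_cast; ring
  have hpt : Tendsto (fun δ : ℝ => (((δ - 1) / a : ℝ) : ℂ)) (𝓝[>] 0) (𝓝[≠] (-(1 / (a : ℂ)))) := by
    refine tendsto_nhdsWithin_iff.2 ⟨tendsto_ofReal_sub_one_div a, ?_⟩
    filter_upwards [self_mem_nhdsWithin] with δ hδ
    have hδ : 0 < δ := hδ
    simp only [hpoint, mem_compl_iff, mem_singleton_iff, add_eq_left, Complex.ofReal_eq_zero]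
    positivity
  have hprod : ∀ᶠ δ : ℝ in 𝓝[>] 0,
      ∏ j ∈ Finset.range N, ((b : ℂ) * (((δ - 1) / a : ℝ) : ℂ) + j + 1) ≠ 0 :=
    ((analyticAt_prod_linear b N _).continuousAt.tendsto.comp
      (tendsto_ofReal_sub_one_div a)).eventually_ne (prod_linear_ne_zero ha hN')
  have hlimF : Tendsto (fun δ : ℝ => ((δ ^ (1 + ((b / a : ℝ) - 1) / p) : ℝ) : ℂ) *
      F (-(1 / (a : ℂ)) + ((δ / a : ℝ) : ℂ))) (𝓝[>] 0) (𝓝 c) := by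
    refine hlim.congr' ?_
    filter_upwards [hpt.eventually hFm.eventually_analyticAt, hprod, self_mem_nhdsWithin]
      with δ hFδ hpδ hδ
    have hδ : 0 < δ := hδ
    have hs : (((δ - 1) / a : ℝ) : ℂ) ∈ halfPlane (-(1 / (a : ℝ))) := by
      change -(1 / (a : ℝ)) < (((δ - 1) / a : ℝ) : ℂ).re
      rw [Complex.ofReal_re, ← neg_div]
      gcongr
      linarith
    -- Uniqueness gives agreement only on punctured neighbourhoods; for small `δ` both functions are
    -- continuous at the point itself, so their values agree there too.
    have heq := eventuallyEq_of_eqOn_halfPlane (d := 0) (neg_nonpos.2 (by positivity))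
      (hF.mono_set hD) (meromorphicOn_contZ ha hb hN hp hq0 hqa hΦ hΦc)
      (hFZ.trans (eqOn_contZ ha hp hq0 hqe hqa hφ hc).symm) hs
    rw [← hpoint, ((hFδ.continuousAt.eventuallyEq_nhds_iff_eventuallyEq_nhdsNE
      (analyticAt_contZ ha hb hN hp hq0 hqa hΦ hΦc hs hpδ).continuousAt).1 heq).eq_of_nhds]
  obtain ⟨n, hn⟩ := exists_int_of_tendsto_rpow_mul hFm ha' hc0 hlimF
  exact hint ⟨n - 1, by push_cast; linarith⟩

theorem exists_isTestFun_apply_ne_zero {U : Set (ℝ × ℝ)} (hU : IsOpen U) (hU0 : (0, 0) ∈ U) :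
    ∃ φ, IsTestFun U φ ∧ φ (0, 0) ≠ 0 := by
  obtain ⟨φ, hsupp, hcomp, hsmooth, -, h1⟩ :=
    exists_contDiff_tsupport_subset (n := (⊤ : ℕ∞)) (hU.mem_nhds hU0)
  exact ⟨φ, ⟨hsmooth, hcomp, hsupp⟩, by rw [h1]; exact one_ne_zero⟩

end Main

end LocalZeta

theorem corollary3p2 (a b q : ℕ) (p : ℝ) (ha : 2 ≤ a) (hab : a ≤ b) (hp : 0 < p)
    (hq_even : Even q) (hq : 2 ≤ q) (hqa : q ≤ a)
    (hcase : p < (b : ℝ) / (a : ℝ) - 1 ∨ ¬ ∃ n : ℤ, Odd n ∧ (b : ℝ) / (a : ℝ) = (n : ℝ))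
    (hint : ¬ ∃ n : ℤ, ((b : ℝ) / (a : ℝ) - 1) / p = (n : ℝ))
    (U : Set (ℝ × ℝ)) (hU : IsOpen U) (hU0 : (0, 0) ∈ U) :
    (∀ φ : ℝ × ℝ → ℝ, LocalZeta.IsTestFun U φ →
      LocalZeta.HasMeromorphicContinuation (LocalZeta.modelFun a b q p) φ
        (LocalZeta.halfPlane (-(1 / (a : ℝ)))) ∧
      (φ (0, 0) ≠ 0 → ∀ V : Set ℂ, IsOpen V → (-(1 / (a : ℂ))) ∈ V →
        ¬ LocalZeta.HasMeromorphicContinuation (LocalZeta.modelFun a b q p) φ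
          (LocalZeta.halfPlane (-(1 / (a : ℝ))) ∪ V))) ∧
    LocalZeta.m0 U (LocalZeta.modelFun a b q p) = ENNReal.ofReal (1 / (a : ℝ)) := by
  have ha0 : 0 < a := by omega
  have hb0 : 0 < b := by omega
  have hq0 : 0 < q := by omega
  have ha' : (0 : ℝ) < a := by exact_mod_cast ha0
  -- The case `a = b` is excluded because `(b/a - 1)/p` would be the integer `0`.
  have hba : 1 < (b : ℝ) / a := by
    refine lt_of_le_of_ne ?_ fun h => hint ⟨0, by rw [← h]; simp⟩
    rw [one_le_div ha']
    exact_mod_cast hab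
  refine ⟨fun φ hφ => ⟨LocalZeta.hasMeromorphicContinuation_modelFun ha0 hb0 hp hq0 hq_even hqa
    hφ.smooth hφ.compact_support, fun h0 V _ hmem =>
    LocalZeta.not_hasMeromorphicContinuation_modelFun ha0 hb0 hp hq hq_even hqa hba hcase hint
      hφ.smooth hφ.compact_support h0 Set.subset_union_left (Or.inr hmem)⟩, le_antisymm ?_ ?_⟩
  · obtain ⟨φ, hφ, h0⟩ := LocalZeta.exists_isTestFun_apply_ne_zero hU hU0
    have hle : LocalZeta.m0 U (LocalZeta.modelFun a b q p) ≤
        LocalZeta.m0At (LocalZeta.modelFun a b q p) φ := sInf_le (by exact ⟨φ, hφ, rfl⟩)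
    refine hle.trans (sSup_le ?_)
    rintro t ⟨ρ, -, hcont, rfl⟩
    refine ENNReal.ofReal_le_ofReal ?_
    by_contra! hlt
    refine LocalZeta.not_hasMeromorphicContinuation_modelFun ha0 hb0 hp hq hq_even hqa hba hcase hint
      hφ.smooth hφ.compact_support h0 (D := LocalZeta.halfPlane (-ρ)) ?_ ?_ hcont
    · intro s hs
      exact (neg_lt_neg hlt).trans hs
    · change -ρ < (-(1 / (a : ℂ))).re
      rw [show (-(1 / (a : ℂ))) = ((-(1 / (a : ℝ)) : ℝ) : ℂ) by push_cast; ring, Complex.ofReal_re]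
      exact neg_lt_neg hlt
  · refine le_sInf ?_
    rintro t ⟨φ, hφ, rfl⟩
    rw [LocalZeta.m0At]
    refine le_sSup ?_
    exact ⟨1 / a, by positivity, LocalZeta.hasMeromorphicContinuation_modelFun ha0 hb0 hp
      hq0 hq_even hqa hφ.smooth hφ.compact_support, rfl⟩
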